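/- Let $\mathfrak g$ be a simple finite-dimensional complex Lie algebra with Cartan matrix $C_{ij}=\langle\alpha_i^\vee,\alpha_j\rangle$, Weyl group $W$, fundamental weights $\omega_i$, and relatively prime positive integers $r_i$ with $r_iC_{ij}=r_jC_{ji}$. Call $(q,t)\in(\mathbb C^*)^2$ generic if $q^at^b=1$ with $a,b\in\mathbb Z$ only for $a=b=0$; let $p_i=q^{r_i}t^{-1}$ and $[n]_q=\frac{q^n-q^{-n}}{q-q^{-1}}$. The deformed Heisenberg algebra has generators $a_i[m]$ with $[a_i[m],a_j[n]]=\frac1m(q^m-q^{-m})(t^m-t^{-m})B_{ij}(q^m,t^m)\delta_{m+n,0}$, where $B_{ij}(q,t)=[r_i]_q\,C_{ij}(q,t)$ and $C_{ij}(q,t)=(p_i+p_i^{-1})\delta_{ij}-[2\delta_{ij}-C_{ij}]_q$; define $y_j[m]$ by $a_i[m]=\sum_jC_{ji}(q^m,t^m)\,y_j[m]$. Let $t=q^\beta$, let $r^\vee$ be the maximal number of edges joining two vertices of the Dynkin diagram, let $(\cdot,\cdot)$ be the invariant form with $r_i=r^\vee(\alpha_i,\alpha_i)/2$, and let $\rho,\rho^\vee$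 be defined by $(\rho,\alpha_i^\vee)=(\rho^\vee,\alpha_i)=1$. Let $F(\mu)$ be the Fock module generated by a vacuum on which $a_i[0]=(\mu,\alpha_i)$ and $a_i[m]=0$ for $m>0$. Put $$Y_i(z)=t^{2(\rho^\vee,\omega_i)}q^{-2r^\vee(\rho,\omega_i)+2y_i[0]}:\!\exp\Big(\sum_{m\ne0}y_i[m]z^{-m}\Big)\!:,\qquad A_i(z)=t^{2(\rho^\vee,\alpha_i)}q^{-2r^\vee(\rho,\alpha_i)+2a_i[0]}:\!\exp\Big(\sum_{m\neq0}a_i[m]z^{-m}\Big)\!:.$$ The screening operators $S_i^+:F(0)\to F(-\beta\alpha_i^\vee)$ and $S_i^-:F(0)\to F(r^\vee\alpha_i)$ are the coefficients of $z^{-1}$ in $:\!\exp\big(\sum_{m\ne0}\frac{a_i[m]}{q^{mr_i}-q^{-mr_i}}z^{-m}\big)\!:$ and $:\!\exp\big(-\sum_{m\ne0}\frac{a_i[m]}{t^{m}-t^{-m}}z^{-m}\big)\!:$, respectively, followed by the shift of vacua. Fix $i$, a finite set $P$ of weights with multiplicities $\mathrm{mult}\,\lambda\ge1$ (for instance the weights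 of the irreducible finite-dimensional $U_q(\widehat{\mathfrak g})$-module $V(\omega_i)$), with $\omega_i\in P$ of multiplicity one, and for $\lambda\in P$, $1\le k\le\mathrm{mult}\,\lambda$, a monomial $$Y_\lambda^{(k)}(z)=\;:\!Y_i(z)A_{i_1}(zq^{a_1}t^{b_1})^{-1}\cdots A_{i_n}(zq^{a_n}t^{b_n})^{-1}\!:,\qquad \lambda=\omega_i-\sum_j\alpha_{i_j},$$ with integers $a_j,b_j$; the triples $(i_j,a_j,b_j)$ do not depend on $(q,t)$. Let $c_\lambda^{\omega_i,(k)}(q,t)\in\mathbb C$ be such that for every generic $(q,t)$ the field $$T_i(z)=\sum_{\lambda\in P}\sum_{k=1}^{\mathrm{mult}\,\lambda}c_\lambda^{\omega_i,(k)}(q,t)\,Y_\lambda^{(k)}(z),\qquad c_{\omega_i}^{\omega_i}(q,t)=1,$$ satisfies the following three conditions. 1. All its Fourier modes commute with all the screening operators $S_j^\pm$. 2. It is obtained by pasting $\mathfrak{sl}_2$ directions. That is, for each $j$ it is a linear combination of $\mathfrak{sl}_2$-strings in direction $j$, which are the sums $$\sum_{S\subseteq X}\ \prod_{x\in S,\,y\in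 X\setminus S}g_j(z_x/z_y)\;:\!M\prod_{x\in S}A_j(z_xp_j^{-1})^{-1}\!:,\qquad g_j(s)=\frac{(q^{r_j}-q^{-r_j}s)(t^{-1}-ts)}{(1-s)(q^{r_j}t^{-1}-q^{-r_j}ts)}.$$ Here $M$ is a normally ordered monomial in the fields $Y_l(zq^at^b)^{\pm1}$, $a,b\in\mathbb Z$, whose $Y_j$-part is $\prod_{x\in X}Y_j(z_x)$ with pairwise distinct $z_x=zq^{a_x}t^{b_x}$, no quotient $z_x/z_y$ being equal to $p_j^2$. 3. It is the only combination of the given monomials that has property 2 and coefficient $1$ at the highest component $Y_i(z)$. Then for all generic $(q,t)$ the following hold. (a) $c_\lambda^{\omega_i,(k)}(q^{-1},t^{-1})=c_\lambda^{\omega_i,(k)}(q,t)$ for all $\lambda$ and $k$. (b) For every $w\in W$ and every weight $\lambda$, $$\sum_{k}c_{w\lambda}^{\omega_i,(k)}(q,t)=\sum_{k}c_\lambda^{\omega_i,(k)}(q,t),$$ where each sum runs over the terms of the weight concerned (and is $0$ if there are none). In particular, if $\lambda$ and $w\lambda$ have multiplicity one, then $c_{w\lambda}^{\omega_i}(q,t)=c_\lambda^{\omega_i}(q,t)$.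 (c) If $\mathfrak g$ is simply-laced, then $c_\lambda^{\omega_i,(k)}(t,q)=c_\lambda^{\omega_i,(k)}(q,t)$ for all $\lambda$ and $k$. -/

import Mathlib

open scoped BigOperators

noncomputable section

namespace DeformedW

/-! ### Simple Lie algebras through their Cartan matrices -/

/-- The Cartan matrix `C` of a simple finite dimensional complex Lie algebra, with
`C i j = ⟨α_i^∨, α_j⟩`, together with the relatively prime positive integers `r i` for which
`diag(r) * C` is symmetric (so `r i` is half the squared length of the simple root `α_i`, in the
normalization in which these numbers are coprime). -/
structure SimpleCartanDatum (ι : Type*) [Fintype ι] [DecidableEq ι] where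
  C : Matrix ι ι ℤ
  r : ι → ℕ
  nonempty : Nonempty ι
  diag : ∀ i, C i i = 2
  offDiag : ∀ i j, i ≠ j → C i j ≤ 0
  symm : ∀ i j, (r i : ℤ) * C i j = (r j : ℤ) * C j i
  posDef : ∀ v : ι → ℝ, v ≠ 0 → 0 < ∑ i, ∑ j, v i * ((r i : ℝ) * (C i j : ℝ)) * v j
  indecomposable : ∀ S : Finset ι, S.Nonempty → (∀ i ∈ S, ∀ j ∉ S, C i j = 0) → S = Finset.univ
  coprime : Finset.univ.gcd r = 1

variable {ι : Type*} [Fintype ι] [DecidableEq ι]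

namespace SimpleCartanDatum

/-- Weights are written in the basis of fundamental weights: `lam i = ⟨lam, α_i^∨⟩`.
This is the fundamental weight `ω_i`. -/
def fundWeight (_g : SimpleCartanDatum ι) (i : ι) : ι → ℤ := Pi.single i 1

/-- The simple root `α_j = ∑ i, C i j ω_i`. -/
def simpleRoot (g : SimpleCartanDatum ι) (j : ι) : ι → ℤ := fun i => g.C i j

/-- The simple reflection `lam ↦ lam - ⟨lam, α_i^∨⟩ α_i`. -/
def simpleReflection (g : SimpleCartanDatum ι) (i : ι) : (ι → ℤ) ≃ₗ[ℤ] (ι → ℤ) :=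
  Module.reflection (x := g.simpleRoot i) (f := LinearMap.proj i) (g.diag i)

/-- The Weyl group, acting on the weight lattice. -/
def weylGroup (g : SimpleCartanDatum ι) : Subgroup ((ι → ℤ) ≃ₗ[ℤ] (ι → ℤ)) :=
  Subgroup.closure (Set.range g.simpleReflection)

/-- The integer `2 (ρ^∨, ω_j)`, where `(ρ^∨, α_k) = 1` for all `k`
(as `2 ρ^∨` is the sum of the positive coroots, the floor is applied to an integer). -/
def twoRhoCheck (g : SimpleCartanDatum ι) (j : ι) : ℤ :=
  ⌊2 * ∑ k, (g.C.map (Int.cast : ℤ → ℚ))⁻¹ k j⌋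

/-- The integer `2 r^∨ (ρ, ω_j)`, where `r^∨ (ρ, α_k) = r k` for all `k`. -/
def twoRho (g : SimpleCartanDatum ι) (j : ι) : ℤ :=
  ⌊2 * ∑ k, (g.r k : ℚ) * (g.C.map (Int.cast : ℤ → ℚ))⁻¹ k j⌋

end SimpleCartanDatum

/-- Generic deformation parameters: `q` and `t` are non-zero and multiplicatively independent. -/
def Generic (q t : ℂ) : Prop :=
  q ≠ 0 ∧ t ≠ 0 ∧ ∀ a b : ℤ, q ^ a * t ^ b = 1 → a = 0 ∧ b = 0

/-! ### The deformed Heisenberg algebra and its Fock modules -/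

/-- `[n]_q = (q^n - q^{-n}) / (q - q^{-1})`. -/
def qInt (n : ℤ) (q : ℂ) : ℂ := (q ^ n - q ^ (-n)) / (q - q⁻¹)

/-- The deformed Cartan matrix
`C_ij(q,t) = (q^{r_i} t^{-1} + q^{-r_i} t) δ_ij - [2 δ_ij - C_ij]_q`. -/
def deformedCartan (g : SimpleCartanDatum ι) (q t : ℂ) : Matrix ι ι ℂ := fun i j =>
  (if i = j then q ^ (g.r i) * t⁻¹ + (q ^ (g.r i))⁻¹ * t else 0)
    - qInt ((if i = j then 2 else 0) - g.C i j) q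

/-- `B(q,t) = D(q,t) C(q,t)` with `D_ij(q,t) = [r_i]_q δ_ij`. -/
def deformedB (g : SimpleCartanDatum ι) (q t : ℂ) : Matrix ι ι ℂ :=
  Matrix.diagonal (fun i => qInt (g.r i) q) * deformedCartan g q t

/-- The scalar `[a_i[m], a_j[-m]] = (1/m) (q^m - q^{-m}) (t^m - t^{-m}) B_ij(q^m, t^m)`. -/
def heisBracket (g : SimpleCartanDatum ι) (q t : ℂ) (i j : ι) (m : ℤ) : ℂ :=
  (1 / (m : ℂ)) * (q ^ m - q ^ (-m)) * (t ^ m - t ^ (-m)) * deformedB g (q ^ m) (t ^ m) i j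

/-- The space underlying every Fock module `F(μ)`: it is freely generated from the vacuum `1` by
the commuting operators `a_i[-n]`, `n ≥ 1`, which act as multiplication by the variable `(i, n)`.
For `n ≥ 1` the operator `a_i[n]` kills the vacuum, hence acts as the derivation with
`a_i[n] · X (j, n') = δ_{n n'} [a_i[n], a_j[-n]]`. -/
abbrev Fock (ι : Type*) := MvPolynomial (ι × ℕ+) ℂ

/-- `exp (∑_{n ≥ 1} v[-n] z^n)`, where `v[m] = ∑_i v m i • a_i[m]`. -/
def creationPart (v : ℤ → ι → ℂ) : PowerSeries (Fock ι) :=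
  PowerSeries.subst
    (PowerSeries.mk fun n : ℕ =>
      if h : 0 < n then
        ∑ i, MvPolynomial.C (v (-(n : ℤ)) i) * MvPolynomial.X ((i, ⟨n, h⟩) : ι × ℕ+)
      else (0 : Fock ι))
    (PowerSeries.exp (Fock ι))

/-- `exp (∑_{n ≥ 1} v[n] z^{-n})`, where `v[m] = ∑_i v m i • a_i[m]`. Being the exponential of a
derivation, it is the `ℂ`-algebra homomorphism that shifts the variable `(j, n)` by
`z^{-n} ∑_i v n i [a_i[n], a_j[-n]]`. -/
def annihilationPart (g : SimpleCartanDatum ι) (q t : ℂ) (v : ℤ → ι → ℂ) :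
    Fock ι →+* LaurentSeries (Fock ι) :=
  MvPolynomial.eval₂Hom (HahnSeries.C.comp MvPolynomial.C) fun p : ι × ℕ+ =>
    HahnSeries.single (0 : ℤ) (MvPolynomial.X p : Fock ι) +
      HahnSeries.single (-((p.2 : ℕ) : ℤ))
        (MvPolynomial.C (∑ i, v ((p.2 : ℕ) : ℤ) i * heisBracket g q t i p.1 ((p.2 : ℕ) : ℤ)))

/-- The normally ordered exponential `:exp (∑_{m ≠ 0} v[m] z^{-m}):`, where
`v[m] = ∑_i v m i • a_i[m]`, as a map from the Fock module to Laurent series in `z` with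
coefficients in the Fock module. -/
def normalExp (g : SimpleCartanDatum ι) (q t : ℂ) (v : ℤ → ι → ℂ) (f : Fock ι) :
    LaurentSeries (Fock ι) :=
  HahnSeries.ofPowerSeries ℤ (Fock ι) (creationPart v) * annihilationPart g q t v f

/-- The fundamental weight type generators: `y_j[m] = ∑_k (C(q^m,t^m)⁻¹)_{kj} a_k[m]`, i.e. the
solution of `a_i[m] = ∑_j C_ji(q^m,t^m) y_j[m]`. -/
def yMode (g : SimpleCartanDatum ι) (q t : ℂ) (j : ι) (m : ℤ) : ι → ℂ :=
  fun k => (deformedCartan g (q ^ m) (t ^ m))⁻¹ k j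

/-! ### Normally ordered monomials in the fields `Y_j` -/

/-- The exponent `M` stands for the normally ordered product
`:∏ Y_j(z q^a t^b)^{M (j,a,b)}:`. -/
abbrev YMonomial (ι : Type*) := (ι × ℤ × ℤ) →₀ ℤ

/-- The exponent of
`A_i(z q^a t^b) = :Y_i(z q^{a+r_i} t^{b-1}) Y_i(z q^{a-r_i} t^{b+1})
  ∏_{j ≠ i} ∏_{k < -C_ji} Y_j(z q^{a - C_ji - 1 - 2k} t^b)^{-1}:`,
which is `A_i` written through `a_i[m] = ∑_j C_ji(q^m,t^m) y_j[m]`. -/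
def aMonomial (g : SimpleCartanDatum ι) (i : ι) (a b : ℤ) : YMonomial ι :=
  Finsupp.single (i, a + g.r i, b - 1) 1 + Finsupp.single (i, a - g.r i, b + 1) 1
    - ∑ j ∈ Finset.univ.erase i, ∑ k ∈ Finset.range (-(g.C j i)).toNat,
        Finsupp.single (j, a - g.C j i - 1 - 2 * (k : ℤ), b) 1

/-- The exponent of `:Y_i(z) A_{i_1}(z q^{a_1} t^{b_1})^{-1} ⋯ A_{i_k}(z q^{a_k} t^{b_k})^{-1}:`
for the multiset `R` of triples `(i_j, a_j, b_j)`. -/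
def termMonomial (g : SimpleCartanDatum ι) (i : ι) (R : Multiset (ι × ℤ × ℤ)) : YMonomial ι :=
  Finsupp.single (i, 0, 0) 1 - (R.map fun x => aMonomial g x.1 x.2.1 x.2.2).sum

/-- The vertex operator `:∏ Y_j(z q^a t^b)^{M (j,a,b)}:` on a Fock module on which the zero mode
factor of `Y_j` acts as the scalar `ζ j`. -/
def monomialField (g : SimpleCartanDatum ι) (q t : ℂ) (ζ : ι → ℂ) (M : YMonomial ι)
    (f : Fock ι) : LaurentSeries (Fock ι) :=
  (M.prod fun x e => ζ x.1 ^ e) •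
    normalExp g q t
      (fun m => M.sum fun x e => ((e : ℂ) * (q ^ x.2.1 * t ^ x.2.2) ^ (-m)) • yMode g q t x.1 m) f

/-- The field attached to a finite linear combination of normally ordered monomials. -/
def field (g : SimpleCartanDatum ι) (q t : ℂ) (ζ : ι → ℂ) (T : YMonomial ι →₀ ℂ)
    (f : Fock ι) : LaurentSeries (Fock ι) :=
  T.sum fun M c => c • monomialField g q t ζ M f

/-! ### Screening operators and their commutant -/

/-- The zero mode factor `t^{2(ρ^∨,ω_j)} q^{-2r^∨(ρ,ω_j) + 2 y_j[0]}` of `Y_j(z)` on `F(0)`. -/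
def vacuumFactor (g : SimpleCartanDatum ι) (q t : ℂ) (j : ι) : ℂ :=
  t ^ g.twoRhoCheck j * q ^ (-g.twoRho j)

/-- The same factor on `F(-β α_i^∨)`, where `q^{2 y_j[0]} = t^{-2 δ_ij}` as `t = q^β`. -/
def plusFactor (g : SimpleCartanDatum ι) (q t : ℂ) (i j : ι) : ℂ :=
  vacuumFactor g q t j * (if i = j then t ^ (-2 : ℤ) else 1)

/-- The same factor on `F(r^∨ α_i)`, where `q^{2 y_j[0]} = q^{2 r_i δ_ij}`. -/
def minusFactor (g : SimpleCartanDatum ι) (q t : ℂ) (i j : ι) : ℂ :=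
  vacuumFactor g q t j * (if i = j then q ^ (2 * g.r i) else 1)

/-- The screening operator `S_i^+ = S_i^+[1] : F(0) → F(-β α_i^∨)`: the coefficient of `z^{-1}` in
`S_i^+(z) = e^{-Q_i/r_i} z^{-s_i^+[0]} :exp (∑_{m ≠ 0} s_i^+[m] z^{-m}):`, where
`s_i^+[m] = a_i[m] / (q^{m r_i} - q^{-m r_i})` and `s_i^+[0] = a_i[0] / r_i` vanishes on `F(0)`. -/
def screeningPlus (g : SimpleCartanDatum ι) (q t : ℂ) (i : ι) (f : Fock ι) : Fock ι :=
  (normalExp g q t (fun m => Pi.single i (1 / (q ^ (m * g.r i) - q ^ (-(m * g.r i))))) f).coeff (-1)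

/-- The screening operator `S_i^- = S_i^-[1] : F(0) → F(r^∨ α_i)`: the coefficient of `z^{-1}` in
`S_i^-(z) = e^{Q_i/β} z^{s_i^-[0]} :exp (-∑_{m ≠ 0} s_i^-[m] z^{-m}):`, where
`s_i^-[m] = a_i[m] / (t^m - t^{-m})` and `s_i^-[0] = a_i[0] / β` vanishes on `F(0)`. -/
def screeningMinus (g : SimpleCartanDatum ι) (q t : ℂ) (i : ι) (f : Fock ι) : Fock ι :=
  (normalExp g q t (fun m => Pi.single i (-(1 / (t ^ m - t ^ (-m))))) f).coeff (-1)

/-- All Fourier modes of the field `T(z)` commute with all the screening operators. -/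
def CommutesWithScreening (g : SimpleCartanDatum ι) (q t : ℂ) (T : YMonomial ι →₀ ℂ) : Prop :=
  ∀ (i : ι) (f : Fock ι) (n : ℤ),
    (field g q t (plusFactor g q t i) T (screeningPlus g q t i f)).coeff n =
        screeningPlus g q t i ((field g q t (vacuumFactor g q t) T f).coeff n) ∧
    (field g q t (minusFactor g q t i) T (screeningMinus g q t i f)).coeff n =
        screeningMinus g q t i ((field g q t (vacuumFactor g q t) T f).coeff n)

/-! ### Pasting of `sl₂` directions -/

/-- The arguments `(a, b)` such that `Y_i(z q^a t^b)` occurs in `M`. -/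
def positions (i : ι) (M : YMonomial ι) : Finset (ℤ × ℤ) :=
  (M.support.filter fun x => x.1 = i).image Prod.snd

/-- The quotient `η^{(++)}(q,t;ξ) / η^{(-+)}(q,t;ξ)` as a function of `s = ξ²`, where
`η^{(++)} = (q ξ⁻¹ - q⁻¹ ξ) / (ξ⁻¹ - ξ)` and
`η^{(-+)} = (q t⁻¹ ξ⁻¹ - q⁻¹ t ξ) / (t⁻¹ ξ⁻¹ - t ξ)`. -/
def etaRatio (q t s : ℂ) : ℂ :=
  ((q - q⁻¹ * s) * (t⁻¹ - t * s)) / ((1 - s) * (q * t⁻¹ - q⁻¹ * t * s))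

/-- The coefficient `γ = ∏_{x ∈ M₋, y ∈ M₊} η^{(++)}_{xy} / η^{(-+)}_{xy}`, with `q` replaced by
`q^{r_i}` in the `η`'s, of the term of an `sl₂` string in direction `i` with arguments
`z_x = z q^a t^b`, `x = (a, b) ∈ X`, in which the signs are `-` on `S = M₋` and `+` on
`X \ S = M₊`; here `ξ_xy² = z_x / z_y`. -/
def gammaCoeff (g : SimpleCartanDatum ι) (q t : ℂ) (i : ι) (X S : Finset (ℤ × ℤ)) : ℂ :=
  ∏ x ∈ S, ∏ y ∈ X \ S, etaRatio (q ^ g.r i) t (q ^ (x.1 - y.1) * t ^ (x.2 - y.2))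

/-- The monomial `M` can be the highest component of an `sl₂` string in direction `i` given by the
explicit coefficients `γ`: the fields `Y_i` occur in it to positive powers, at pairwise distinct
arguments (coinciding arguments give derivative terms), and no ratio `z_x / z_y` of two arguments
equals `q^{2 r_i} t^{-2}` (for such a ratio a coefficient `γ` is singular). -/
def IsTop (g : SimpleCartanDatum ι) (i : ι) (M : YMonomial ι) : Prop :=
  (∀ x : ℤ × ℤ, M (i, x) = 0 ∨ M (i, x) = 1) ∧
    ∀ x ∈ positions i M, ∀ y ∈ positions i M,
      ¬ (x.1 - y.1 = 2 * (g.r i : ℤ) ∧ x.2 - y.2 = -2)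

/-- The completion of the monomial `M` in the `sl₂` direction `i`, which replaces `Y_i(z_x)` by
`Y_i(z_x) + Y_i(z_x) A_i(z_x q^{-r_i} t)^{-1}` with coefficients `γ`: the sum over the subsets `S`
of the positions of `Y_i` in `M` of
`γ_S(q,t) :M ∏_{(a,b) ∈ S} A_i(z q^{a - r_i} t^{b+1})^{-1}:`. -/
def slTwoString (g : SimpleCartanDatum ι) (q t : ℂ) (i : ι) (M : YMonomial ι) :
    YMonomial ι →₀ ℂ :=
  ∑ S ∈ (positions i M).powerset,
    Finsupp.single (M - ∑ x ∈ S, aMonomial g i (x.1 - g.r i) (x.2 + 1))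
      (gammaCoeff g q t i (positions i M) S)

/-- `T` is pasted from `sl₂` directions: in every direction `i` it is a linear combination of
`sl₂` strings. -/
def IsPasted (g : SimpleCartanDatum ι) (q t : ℂ) (T : YMonomial ι →₀ ℂ) : Prop :=
  ∀ i, T ∈ Submodule.span ℂ {B | ∃ M, IsTop g i M ∧ B = slTwoString g q t i M}

/-! ### The fundamental generators -/

/-- `∑_lam ∑_{k = 1}^{mult lam} c_lam^{(k)} Y_lam^{(k)}`, where `Y_lam^{(k)}` is the monomial
`:Y_i(z) A_{i_1}(z q^{a_1} t^{b_1})^{-1} ⋯:` given by the triples in `R lam k`. -/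
def generatorSum (g : SimpleCartanDatum ι) (i : ι) (mult : (ι → ℤ) →₀ ℕ)
    (R : (lam : ι → ℤ) → Fin (mult lam) → Multiset (ι × ℤ × ℤ))
    (c : (lam : ι → ℤ) → Fin (mult lam) → ℂ) : YMonomial ι →₀ ℂ :=
  ∑ lam ∈ mult.support, ∑ k : Fin (mult lam),
    Finsupp.single (termMonomial g i (R lam k)) (c lam k)

/-- The assumption on the generator `T_i(z)` of the deformed `W`-algebra with highest component
`Y_i(z)`. The finitely supported function `mult` gives the weights and their multiplicities, the
multisets `R lam k` give the monomials `Y_lam^{(k)}(z)`, which do not depend on `(q, t)`, and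
`c q t lam k` is the coefficient `c_lam^{(k)}(q,t)`. -/
structure IsGenerator (g : SimpleCartanDatum ι) (i : ι) (mult : (ι → ℤ) →₀ ℕ)
    (R : (lam : ι → ℤ) → Fin (mult lam) → Multiset (ι × ℤ × ℤ))
    (c : ℂ → ℂ → (lam : ι → ℤ) → Fin (mult lam) → ℂ) : Prop where
  /-- The highest weight `ω_i` has multiplicity one. -/
  highest : mult (g.fundWeight i) = 1
  /-- `Y_lam^{(k)}` is `:Y_i ∏ A_{i_j}^{-1}:` with `lam = ω_i - ∑ α_{i_j}`. -/
  weight : ∀ lam k, lam = g.fundWeight i - ((R lam k).map fun x => g.simpleRoot x.1).sum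
  /-- The highest component `Y_i(z)` has coefficient one. -/
  normalized : ∀ q t, Generic q t → ∀ k, c q t (g.fundWeight i) k = 1
  /-- `T_i(z)` belongs to the commutant of the screening operators. -/
  commutes : ∀ q t, Generic q t → CommutesWithScreening g q t (generatorSum g i mult R (c q t))
  /-- `T_i(z)` is obtained by pasting `sl₂` directions. -/
  pasted : ∀ q t, Generic q t → IsPasted g q t (generatorSum g i mult R (c q t))
  /-- Pasting determines `T_i(z)` from its highest component. (In particular the monomials
  `Y_lam^{(k)}` are pairwise distinct.) -/
  unique : ∀ q t, Generic q t → ∀ c' : (lam : ι → ℤ) → Fin (mult lam) → ℂ,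
    (∀ k, c' (g.fundWeight i) k = 1) → IsPasted g q t (generatorSum g i mult R c') →
      c' = c q t

end DeformedW

end

/-!
The coefficients are pinned down by the pasting property alone, so each symmetry is proved by
exhibiting a symmetry of the `sl₂` strings.

*Inversion.* The function `etaRatio` is unchanged when `q`, `t` and its argument are all inverted.
Hence the strings at `(q⁻¹, t⁻¹)` and at `(q, t)` are the same vectors, and uniqueness at `(q, t)`
applies to the coefficients at `(q⁻¹, t⁻¹)` (`IsGenerator.coeff_inv`).

*Weyl group.* It suffices to treat a simple reflection `s_j` and a single string in direction `j`.
If its highest component `M` has `n` factors `Y_j`, then the `j`-weight of `M` is `n`, and `s_j`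
exchanges the weights of the terms with `#S = k` and with `#S = n - k`. What is needed is therefore
`∑_{#S = k} γ_S = ∑_{#S = k} γ_{X \ S}`. This is the trigonometric case of Ruijsenaars' functional
equation, `splitSum_inv`, for `g(x, y) = (y - a x)(y - b x) / ((y - x)(y - a b x))`. It is proved
by induction on the number of points. As a function of one of the points, `u`, the difference of
the two sides is `F_{a,b}(u) - F_{1/a,1/b}(u)` (`splitSum_insert_sub`). The function `F_{a,b}`
(`halfSum`) could have simple poles at the other points `w` and at the points `w / (a b)`. The
latter do not occur, by the identity for two points less, so that `F_{a,b}(u) ∏ (w - u)` is a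
polynomial whose degree is at most the number of points `w` (`exists_quotient`). The polynomials
for `(a, b)` and for `(1/a, 1/b)` take the same values at all `w` (`eval_quotient_point`,
`poleSum_inv`) and, by the identity for one point less, at `0`; so they are equal.

*Exchange of `q` and `t`.* In the simply-laced case all `r_j` are `1` and each `A_j(z q^a t^b)`
involves only factors `Y_l(z q^c t^d)` with `c + d = a + b`. By `etaRatio_swap`, the flip
`(a, b) ↦ (-b, -a)` of the arguments carries the strings at `(t, q)` to the strings at `(q, t)`
(`slTwoString_flip`). It fixes the monomials with all arguments on the diagonal `a + b = 0`, such
as the highest component `Y_i(z)`. Only such monomials occur in the generator: dropping all others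
preserves the pasting property (`IsPasted.diagonalPart`), because by triangularity the strings
that are used have highest components of the form `:Y_i ∏ A⁻¹:` up to diagonal factors, and
lowering such a monomial neither creates nor destroys the property of being diagonal; uniqueness
then shows that nothing was dropped (`IsGenerator.diagonalPart_generatorSum`).
-/

noncomputable section

namespace DeformedW

open Finset

/-! ### Ruijsenaars' functional equation in the trigonometric case -/

section ExchangeIdentity

open Polynomial

variable {α : Type*}

/-- The kernel `g(x, y) = (y - a x)(y - b x) / ((y - x)(y - a b x))` of the functional equation, a
function of `x / y`. -/
def exchangeKernel (a b x y : ℂ) : ℂ :=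
  (y - a * x) * (y - b * x) / ((y - x) * (y - a * b * x))

/-- Inverting the parameters exchanges the arguments; this is why one side of the functional
equation is the other one for the inverse parameters. -/
lemma exchangeKernel_inv {a b : ℂ} (ha : a ≠ 0) (hb : b ≠ 0) (x y : ℂ) :
    exchangeKernel a⁻¹ b⁻¹ x y = exchangeKernel a b y x := by
  unfold exchangeKernel
  rw [← mul_div_mul_left ((y - a⁻¹ * x) * (y - b⁻¹ * x)) _ (mul_ne_zero ha hb)]
  congr 1
  · field_simp
    ring
  · field_simp
    ring

lemma exchangeKernel_shift {a b : ℂ} (ha : a ≠ 0) (hb : b ≠ 0) (x w : ℂ) :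
    exchangeKernel a b (w / (a * b)) x = exchangeKernel a b x w := by
  unfold exchangeKernel
  rw [← mul_div_mul_left _ ((x - w / (a * b)) * _) (mul_ne_zero ha hb)]
  congr 1
  · field_simp
    ring
  · field_simp
    ring

/-- The kernel between the points `z x` and `z y`. -/
def pointKernel (a b : ℂ) (z : α → ℂ) (x y : α) : ℂ := exchangeKernel a b (z x) (z y)

lemma pointKernel_inv {a b : ℂ} (ha : a ≠ 0) (hb : b ≠ 0) (z : α → ℂ) (x y : α) :
    pointKernel a⁻¹ b⁻¹ z x y = pointKernel a b z y x :=
  exchangeKernel_inv ha hb _ _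

/-- The points `z x`, `x ∈ J`, are non-zero and pairwise distinct, and no kernel between them is
singular. For `x = y` the last condition says that `a * b ≠ 1`. -/
structure Admissible (a b : ℂ) (z : α → ℂ) (J : Finset α) : Prop where
  ne_zero : ∀ x ∈ J, z x ≠ 0
  injOn : ∀ x ∈ J, ∀ y ∈ J, x ≠ y → z x ≠ z y
  ne_mul : ∀ x ∈ J, ∀ y ∈ J, z y ≠ a * b * z x

lemma Admissible.mono {a b : ℂ} {z : α → ℂ} {J K : Finset α} (h : Admissible a b z J)
    (hK : K ⊆ J) : Admissible a b z K :=
  ⟨fun x hx => h.1 x (hK hx), fun x hx y hy => h.2 x (hK hx) y (hK hy),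
    fun x hx y hy => h.3 x (hK hx) y (hK hy)⟩

lemma Admissible.inv {a b : ℂ} (ha : a ≠ 0) (hb : b ≠ 0) {z : α → ℂ} {J : Finset α}
    (h : Admissible a b z J) : Admissible a⁻¹ b⁻¹ z J := by
  refine ⟨h.1, h.2, fun x hx y hy e => h.3 y hy x hx ?_⟩
  rw [e]
  field_simp

/-- The numerator of `exchangeKernel a b u c`, as a function of `u`. -/
def poleNumer (a b c u : ℂ) : ℂ := (c - a * u) * (c - b * u)

/-- The denominator of `exchangeKernel a b u c`, as a function of `u`. -/
def poleDenom (a b c u : ℂ) : ℂ := (c - u) * (c - a * b * u)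

lemma exchangeKernel_mul_poleDenom {a b c u : ℂ} (h : poleDenom a b c u ≠ 0) :
    exchangeKernel a b u c * poleDenom a b c u = poleNumer a b c u :=
  div_mul_cancel₀ _ h

lemma poleDenom_ne_zero {a b : ℂ} {z : α → ℂ} {J : Finset α} (hz : Admissible a b z J)
    {w : α} (hw : w ∈ J) {x : α} (hx : x ∈ J) (hxw : x ≠ w) :
    poleDenom a b (z x) (z w) ≠ 0 :=
  mul_ne_zero (sub_ne_zero.2 (hz.2 x hx w hw hxw)) (sub_ne_zero.2 (hz.3 w hw x hx))

lemma natDegree_prod_two_le {p r : α → ℂ[X]} (hp : ∀ x, (p x).natDegree ≤ 2)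
    (hr : ∀ x, (r x).natDegree ≤ 2) (c : ℂ) {S T J : Finset α} (h : #S + #T = #J) :
    (C c * ((∏ x ∈ S, p x) * ∏ y ∈ T, r y)).natDegree ≤ 2 * #J := by
  have h1 : (∏ x ∈ S, p x).natDegree ≤ #S * 2 :=
    (natDegree_prod_le _ _).trans (sum_le_card_nsmul _ _ _ fun x _ => hp x)
  have h2 : (∏ x ∈ T, r x).natDegree ≤ #T * 2 :=
    (natDegree_prod_le _ _).trans (sum_le_card_nsmul _ _ _ fun x _ => hr x)
  refine (natDegree_C_mul_le _ _).trans (natDegree_mul_le.trans ?_)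
  omega

variable [DecidableEq α]

/-- The product of `G x y` over the pairs that the splitting of `J` into `S` and `J \ S` separates,
with `x` in `S`. -/
def splitProd (G : α → α → ℂ) (J S : Finset α) : ℂ :=
  ∏ x ∈ S, ∏ y ∈ J \ S, G x y

lemma insert_sdiff_of_subset {J S : Finset α} {w : α} (hw : w ∉ J) (hS : S ⊆ J) :
    insert w J \ S = insert w (J \ S) :=
  insert_sdiff_of_notMem _ fun h => hw (hS h)

lemma insert_sdiff_insert_of_notMem {J : Finset α} (S : Finset α) {w : α} (hw : w ∉ J) :
    insert w J \ insert w S = J \ S := by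
  ext x
  simp only [mem_sdiff, mem_insert]
  constructor
  · tauto
  · rintro ⟨h1, h2⟩
    refine ⟨Or.inr h1, ?_⟩
    rintro (rfl | h)
    · exact hw h1
    · exact h2 h

lemma splitProd_insert_left (G : α → α → ℂ) {J S : Finset α} {w : α} (hw : w ∉ J) (hS : S ⊆ J) :
    splitProd G (insert w J) S = splitProd G J S * ∏ x ∈ S, G x w := by
  unfold splitProd
  rw [← prod_mul_distrib, insert_sdiff_of_subset hw hS]
  refine prod_congr rfl fun x _ => ?_
  rw [prod_insert (fun h => hw (mem_sdiff.1 h).1), mul_comm]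

lemma splitProd_insert_right (G : α → α → ℂ) {J S : Finset α} {w : α} (hw : w ∉ J) (hS : S ⊆ J) :
    splitProd G (insert w J) (insert w S) = splitProd G J S * ∏ y ∈ J \ S, G w y := by
  unfold splitProd
  rw [insert_sdiff_insert_of_notMem S hw, prod_insert (fun h => hw (hS h)), mul_comm]

/-- One side of the functional equation for the points of `J`. The arbitrary weight `f` of the size
of the subset stands for the generating variable: fixing the size amounts to taking an indicator
function, and adding or removing a point shifts `f`. -/
def splitSum (a b : ℂ) (z : α → ℂ) (J : Finset α) (f : ℕ → ℂ) : ℂ :=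
  ∑ S ∈ J.powerset, f #S * splitProd (pointKernel a b z) J S

/-- The part of the difference of the two sides for the points of `J` and one more point `u` that
consists of the terms in which `u` enters through `exchangeKernel a b u _`. -/
def halfSum (a b : ℂ) (z : α → ℂ) (J : Finset α) (f : ℕ → ℂ) (u : ℂ) : ℂ :=
  ∑ S ∈ J.powerset,
    (f (#S + 1) * splitProd (pointKernel a b z) J S * ∏ y ∈ J \ S, exchangeKernel a b u (z y)
      - f #S * splitProd (pointKernel a⁻¹ b⁻¹ z) J S * ∏ x ∈ S, exchangeKernel a b u (z x))

lemma splitSum_insert_sub {a b : ℂ} (ha : a ≠ 0) (hb : b ≠ 0) (z : α → ℂ) {J : Finset α} {o : α}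
    (ho : o ∉ J) (f : ℕ → ℂ) :
    splitSum a b z (insert o J) f - splitSum a⁻¹ b⁻¹ z (insert o J) f =
      halfSum a b z J f (z o) - halfSum a⁻¹ b⁻¹ z J f (z o) := by
  unfold splitSum halfSum
  rw [sum_powerset_insert ho, sum_powerset_insert ho, ← sum_add_distrib, ← sum_add_distrib,
    ← sum_sub_distrib, ← sum_sub_distrib]
  refine sum_congr rfl fun S hS => ?_
  have hS := mem_powerset.1 hS
  rw [splitProd_insert_left _ ho hS, splitProd_insert_left _ ho hS,
    splitProd_insert_right _ ho hS, splitProd_insert_right _ ho hS,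
    card_insert_of_notMem (fun h => ho (hS h))]
  simp only [pointKernel_inv ha hb, inv_inv, exchangeKernel_inv ha hb]
  simp only [pointKernel]
  ring

/-- `halfSum` multiplied by all denominators containing `u`, so that it is polynomial in `u`. -/
def clearedSum (a b : ℂ) (z : α → ℂ) (J : Finset α) (f : ℕ → ℂ) (u : ℂ) : ℂ :=
  ∑ S ∈ J.powerset,
    (f (#S + 1) * splitProd (pointKernel a b z) J S *
        ((∏ y ∈ J \ S, poleNumer a b (z y) u) * ∏ x ∈ S, poleDenom a b (z x) u)
      - f #S * splitProd (pointKernel a⁻¹ b⁻¹ z) J S *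
        ((∏ x ∈ S, poleNumer a b (z x) u) * ∏ y ∈ J \ S, poleDenom a b (z y) u))

lemma clearedSum_eq_halfSum_mul {a b u : ℂ} {z : α → ℂ} {J : Finset α} (f : ℕ → ℂ)
    (hu : ∀ x ∈ J, poleDenom a b (z x) u ≠ 0) :
    clearedSum a b z J f u = halfSum a b z J f u * ∏ x ∈ J, poleDenom a b (z x) u := by
  unfold clearedSum halfSum
  rw [sum_mul]
  refine sum_congr rfl fun S hS => ?_
  have hS := mem_powerset.1 hS
  have h1 : ∏ y ∈ J \ S, poleNumer a b (z y) u =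
      (∏ y ∈ J \ S, exchangeKernel a b u (z y)) * ∏ y ∈ J \ S, poleDenom a b (z y) u := by
    rw [← prod_mul_distrib]
    exact prod_congr rfl fun y hy =>
      (exchangeKernel_mul_poleDenom (hu y (mem_sdiff.1 hy).1)).symm
  have h2 : ∏ y ∈ S, poleNumer a b (z y) u =
      (∏ y ∈ S, exchangeKernel a b u (z y)) * ∏ y ∈ S, poleDenom a b (z y) u := by
    rw [← prod_mul_distrib]
    exact prod_congr rfl fun y hy => (exchangeKernel_mul_poleDenom (hu y (hS hy))).symm
  rw [h1, h2, ← prod_sdiff hS]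
  ring

/-- The factor that determines the residue of `halfSum` for the points of `J` and `w` at a pole `u`
caused by `w`: the sum over the subsets `S` of `J` of what is left of the two terms that are singular
there, namely the first one for `S` and the second one for `insert w S`. -/
def poleSum (a b : ℂ) (z : α → ℂ) (J : Finset α) (w : α) (f : ℕ → ℂ) (u : ℂ) : ℂ :=
  ∑ S ∈ J.powerset,
    f (#S + 1) * (splitProd (pointKernel a b z) J S * (∏ x ∈ S, pointKernel a b z x w) *
        (∏ y ∈ J \ S, exchangeKernel a b u (z y))
      - splitProd (pointKernel a⁻¹ b⁻¹ z) J S * (∏ y ∈ J \ S, pointKernel a b z y w) *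
        ∏ x ∈ S, exchangeKernel a b u (z x))

/-- At a zero of the denominator belonging to `w`, the terms in which that denominator was not
cancelled vanish. -/
lemma clearedSum_pole {a b u : ℂ} (ha : a ≠ 0) (hb : b ≠ 0) {z : α → ℂ} {J : Finset α} {w : α}
    (hw : w ∉ J) (f : ℕ → ℂ) (hu : ∀ x ∈ J, poleDenom a b (z x) u ≠ 0)
    (hwu : poleDenom a b (z w) u = 0) :
    clearedSum a b z (insert w J) f u =
      poleNumer a b (z w) u * (∏ x ∈ J, poleDenom a b (z x) u) * poleSum a b z J w f u := by
  unfold clearedSum poleSum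
  rw [sum_powerset_insert hw, ← sum_add_distrib, mul_sum]
  refine sum_congr rfl fun S hS => ?_
  have hS := mem_powerset.1 hS
  have hwS : w ∉ S := fun h => hw (hS h)
  have hwJS : w ∉ J \ S := fun h => hw (mem_sdiff.1 h).1
  have h1 : ∏ y ∈ J \ S, poleNumer a b (z y) u =
      (∏ y ∈ J \ S, exchangeKernel a b u (z y)) * ∏ y ∈ J \ S, poleDenom a b (z y) u := by
    rw [← prod_mul_distrib]
    exact prod_congr rfl fun y hy =>
      (exchangeKernel_mul_poleDenom (hu y (mem_sdiff.1 hy).1)).symm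
  have h2 : ∏ y ∈ S, poleNumer a b (z y) u =
      (∏ y ∈ S, exchangeKernel a b u (z y)) * ∏ y ∈ S, poleDenom a b (z y) u := by
    rw [← prod_mul_distrib]
    exact prod_congr rfl fun y hy => (exchangeKernel_mul_poleDenom (hu y (hS hy))).symm
  rw [insert_sdiff_of_subset hw hS, insert_sdiff_insert_of_notMem S hw, prod_insert hwJS,
    prod_insert hwS, prod_insert hwS, prod_insert hwJS, hwu,
    splitProd_insert_left (pointKernel a b z) hw hS,
    splitProd_insert_right (pointKernel a⁻¹ b⁻¹ z) hw hS, card_insert_of_notMem hwS,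
    h1, h2, ← prod_sdiff hS]
  simp only [pointKernel_inv ha hb]
  ring

/-- `clearedSum` as a polynomial in `u`. -/
def clearedPoly (a b : ℂ) (z : α → ℂ) (J : Finset α) (f : ℕ → ℂ) : ℂ[X] :=
  ∑ S ∈ J.powerset,
    (C (f (#S + 1) * splitProd (pointKernel a b z) J S) *
        ((∏ y ∈ J \ S, (C (z y) - C a * X) * (C (z y) - C b * X)) *
          ∏ x ∈ S, (C (z x) - X) * (C (z x) - C (a * b) * X))
      - C (f #S * splitProd (pointKernel a⁻¹ b⁻¹ z) J S) *
        ((∏ x ∈ S, (C (z x) - C a * X) * (C (z x) - C b * X)) *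
          ∏ y ∈ J \ S, (C (z y) - X) * (C (z y) - C (a * b) * X)))

lemma eval_clearedPoly (a b : ℂ) (z : α → ℂ) (J : Finset α) (f : ℕ → ℂ) (u : ℂ) :
    (clearedPoly a b z J f).eval u = clearedSum a b z J f u := by
  simp [clearedPoly, clearedSum, eval_finsetSum, eval_prod, poleNumer, poleDenom]

lemma natDegree_clearedPoly_le (a b : ℂ) (z : α → ℂ) (J : Finset α) (f : ℕ → ℂ) :
    (clearedPoly a b z J f).natDegree ≤ 2 * #J := by
  have key : ∀ c d e : ℂ, ((C c - C d * X) * (C c - C e * X) : ℂ[X]).natDegree ≤ 2 := by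
    intro c d e
    compute_degree
  have key' : ∀ c e : ℂ, ((C c - X) * (C c - C e * X) : ℂ[X]).natDegree ≤ 2 := by
    intro c e
    compute_degree
  refine natDegree_sum_le_of_forall_le _ _ fun S hS => ?_
  have hS := mem_powerset.1 hS
  have hc := card_sdiff_add_card_eq_card hS
  refine (natDegree_sub_le _ _).trans (max_le ?_ ?_)
  · exact natDegree_prod_two_le (fun x => key _ _ _) (fun x => key' _ _) _ hc
  · exact natDegree_prod_two_le (fun x => key _ _ _) (fun x => key' _ _) _ (by omega)

/-- `halfSum` has no poles at the points `z w / (a b)`: there, `poleSum` is a multiple of the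
difference of the two sides for the points other than `w`, which vanishes by assumption. -/
lemma exists_quotient {a b : ℂ} (ha : a ≠ 0) (hb : b ≠ 0) {z : α → ℂ} {J : Finset α}
    (hz : Admissible a b z J)
    (ih : ∀ w ∈ J, ∀ f, splitSum a b z (J.erase w) f = splitSum a⁻¹ b⁻¹ z (J.erase w) f)
    (f : ℕ → ℂ) :
    ∃ Q : ℂ[X], Q.natDegree ≤ #J ∧
      ∀ u, clearedSum a b z J f u = Q.eval u * ∏ x ∈ J, (z x - a * b * u) := by
  have hab := mul_ne_zero ha hb
  have hroot : ∀ w ∈ J, (clearedPoly a b z J f).IsRoot (z w / (a * b)) := by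
    intro w hw
    have hne : ∀ x ∈ J.erase w, poleDenom a b (z x) (z w / (a * b)) ≠ 0 := by
      intro x hx
      obtain ⟨hxw, hx⟩ := mem_erase.1 hx
      refine mul_ne_zero (fun e => hz.3 x hx w hw ?_) (fun e => hz.2 x hx w hw hxw ?_)
      · rw [sub_eq_zero.1 e]; field_simp
      · rw [sub_eq_zero.1 e]; field_simp
    have hpole : poleDenom a b (z w) (z w / (a * b)) = 0 := by
      unfold poleDenom
      rw [mul_div_cancel₀ _ hab, sub_self, mul_zero]
    have hE : poleSum a b z (J.erase w) w f (z w / (a * b)) = 0 := by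
      have : poleSum a b z (J.erase w) w f (z w / (a * b)) =
          (∏ x ∈ J.erase w, pointKernel a b z x w) *
            (splitSum a b z (J.erase w) (fun n => f (n + 1))
              - splitSum a⁻¹ b⁻¹ z (J.erase w) (fun n => f (n + 1))) := by
        unfold poleSum splitSum
        rw [← sum_sub_distrib, mul_sum]
        refine sum_congr rfl fun S hS => ?_
        rw [← prod_sdiff (mem_powerset.1 hS)]
        simp only [exchangeKernel_shift ha hb, pointKernel]
        ring
      rw [this, ih w hw, sub_self, mul_zero]
    rw [IsRoot, eval_clearedPoly]
    conv_lhs => rw [← insert_erase hw]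
    rw [clearedSum_pole ha hb (notMem_erase w J) f hne hpole, hE, mul_zero]
  have hdvd : (∏ x ∈ J, (C (z x) - C (a * b) * X)) ∣ clearedPoly a b z J f := by
    refine prod_dvd_of_coprime ?_ ?_
    · intro x hx y hy hxy
      have h0 : z x - z y ≠ 0 := sub_ne_zero.2 (hz.2 x hx y hy hxy)
      refine ⟨C (z x - z y)⁻¹, -C (z x - z y)⁻¹, ?_⟩
      have : C (z x - z y)⁻¹ * C (z x - z y) = (1 : ℂ[X]) := by
        rw [← C_mul, inv_mul_cancel₀ h0, C_1]
      rw [← this, C_sub]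
      ring
    · intro x hx
      have h := dvd_iff_isRoot.2 (hroot x hx)
      have e : (C (z x) - C (a * b) * X : ℂ[X]) = C (-(a * b)) * (X - C (z x / (a * b))) := by
        rw [mul_sub, ← C_mul, C_neg, neg_mul, neg_mul, mul_div_cancel₀ _ hab, C_neg]
        ring
      rw [e]
      exact (isUnit_C.2 (neg_ne_zero.2 hab).isUnit).mul_left_dvd.2 h
  obtain ⟨Q, hQ⟩ := hdvd
  refine ⟨Q, ?_, fun u => ?_⟩
  · by_cases hQ0 : Q = 0
    · simp [hQ0]
    have hlin : ∀ x, (C (z x) - C (a * b) * X : ℂ[X]).natDegree = 1 := by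
      intro x
      rw [natDegree_sub_eq_right_of_natDegree_lt] <;> simp [natDegree_C_mul_X _ hab, -map_mul]
    have hne : ∀ x ∈ J, (C (z x) - C (a * b) * X : ℂ[X]) ≠ 0 := fun x _ h0 => by
      have := hlin x
      rw [h0] at this
      simp at this
    have h1 := natDegree_clearedPoly_le a b z J f
    rw [hQ, natDegree_mul (prod_ne_zero_iff.2 hne) hQ0, natDegree_prod _ _ hne] at h1
    simp only [hlin, sum_const, smul_eq_mul, mul_one] at h1
    omega
  · rw [← eval_clearedPoly, hQ, eval_mul, eval_prod, mul_comm]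
    simp

lemma clearedSum_zero {a b : ℂ} {z : α → ℂ} {J : Finset α} (f : ℕ → ℂ) :
    clearedSum a b z J f 0 = (∏ x ∈ J, z x ^ 2) *
      (splitSum a b z J (fun n => f (n + 1)) - splitSum a⁻¹ b⁻¹ z J f) := by
  unfold clearedSum splitSum
  rw [← sum_sub_distrib, mul_sum]
  refine sum_congr rfl fun S hS => ?_
  rw [← prod_sdiff (mem_powerset.1 hS)]
  simp only [poleNumer, poleDenom, mul_zero, sub_zero, ← pow_two]
  ring

/-- At `u = z w` the two terms of `poleSum` are exchanged by inverting the parameters. -/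
lemma poleSum_inv {a b : ℂ} (ha : a ≠ 0) (hb : b ≠ 0) {z : α → ℂ} {J : Finset α} (w : α)
    (f : ℕ → ℂ) :
    poleSum a⁻¹ b⁻¹ z J w f (z w) = -poleSum a b z J w f (z w) := by
  unfold poleSum
  rw [← sum_neg_distrib]
  refine sum_congr rfl fun S _ => ?_
  simp only [pointKernel, inv_inv, exchangeKernel_inv ha hb]
  ring

lemma eval_quotient_point {a b : ℂ} (ha : a ≠ 0) (hb : b ≠ 0) {z : α → ℂ} {J : Finset α}
    (hz : Admissible a b z J) {f : ℕ → ℂ} {Q : ℂ[X]}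
    (hQ : ∀ u, clearedSum a b z J f u = Q.eval u * ∏ x ∈ J, (z x - a * b * u))
    {w : α} (hw : w ∈ J) :
    Q.eval (z w) = z w * ((1 - a) * (1 - b) / (1 - a * b)) *
      (∏ x ∈ J.erase w, (z x - z w)) * poleSum a b z (J.erase w) w f (z w) := by
  have hprod : ∏ x ∈ J, (z x - a * b * z w) ≠ 0 :=
    prod_ne_zero_iff.2 fun x hx => sub_ne_zero.2 (hz.3 w hw x hx)
  have hab : 1 - a * b ≠ 0 := by
    intro h
    refine hz.3 w hw w hw ?_
    rw [← sub_eq_zero.1 h, one_mul]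
  apply mul_right_cancel₀ hprod
  rw [← hQ]
  conv_lhs => rw [← insert_erase hw]
  rw [clearedSum_pole ha hb (notMem_erase w J) f (fun x hx =>
    poleDenom_ne_zero hz hw (mem_erase.1 hx).2 (mem_erase.1 hx).1)
    (by simp [poleDenom]), ← mul_prod_erase J _ hw]
  simp only [poleDenom, poleNumer, prod_mul_distrib]
  field_simp

/-- **Ruijsenaars' functional equation**, trigonometric case. By `exchangeKernel_inv` the right-hand
side is the sum of the products of `g(z y, z x)` over `x ∈ S`, `y ∉ S`. -/
theorem splitSum_inv {a b : ℂ} (ha : a ≠ 0) (hb : b ≠ 0) {z : α → ℂ} (I : Finset α)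
    (hz : Admissible a b z I) (f : ℕ → ℂ) :
    splitSum a b z I f = splitSum a⁻¹ b⁻¹ z I f := by
  induction I using Finset.strongInduction generalizing f with
  | H I ih =>
  rcases I.eq_empty_or_nonempty with rfl | ⟨o, ho⟩
  · simp [splitSum, splitProd]
  -- The point `z o` plays the role of the variable `u`.
  set J := I.erase o with hJ
  have hJI : J ⊂ I := erase_ssubset ho
  have hzJ : Admissible a b z J := hz.mono hJI.1
  have hzJ' := hzJ.inv ha hb
  have ihJ : ∀ f, splitSum a b z J f = splitSum a⁻¹ b⁻¹ z J f := ih J hJI hzJ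
  have ihE : ∀ w ∈ J, ∀ f,
      splitSum a b z (J.erase w) f = splitSum a⁻¹ b⁻¹ z (J.erase w) f := fun w _ =>
    ih _ ((erase_subset w J).trans_ssubset hJI) (hzJ.mono (erase_subset w J))
  obtain ⟨Q, hQd, hQ⟩ := exists_quotient ha hb hzJ ihE f
  obtain ⟨Q', hQd', hQ'⟩ := exists_quotient (inv_ne_zero ha) (inv_ne_zero hb) hzJ'
    (fun w hw f => by simpa only [inv_inv] using (ihE w hw f).symm) f
  -- Every kernel tends to `1` as `u` tends to `0`, which leaves the identity for `J`.
  have hzero : Q.eval 0 = Q'.eval 0 := by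
    have h1 := hQ 0
    have h2 := hQ' 0
    rw [clearedSum_zero] at h1 h2
    simp only [inv_inv, mul_zero, sub_zero] at h1 h2
    refine mul_right_cancel₀ (prod_ne_zero_iff.2 hzJ.1) ?_
    rw [← h1, ← h2, ihJ, ihJ]
  have hpt : ∀ w ∈ J, Q.eval (z w) = Q'.eval (z w) := by
    intro w hw
    have hab : 1 - a * b ≠ 0 := by
      intro h
      refine hzJ.3 w hw w hw ?_
      rw [← sub_eq_zero.1 h, one_mul]
    have hab' : a * b - 1 ≠ 0 := by rwa [← neg_ne_zero, neg_sub]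
    rw [eval_quotient_point ha hb hzJ hQ hw,
      eval_quotient_point (inv_ne_zero ha) (inv_ne_zero hb) hzJ' hQ' hw, poleSum_inv ha hb]
    have : (1 - a⁻¹) * (1 - b⁻¹) / (1 - a⁻¹ * b⁻¹) = -((1 - a) * (1 - b) / (1 - a * b)) := by
      have : 1 - a⁻¹ * b⁻¹ = (a * b - 1) / (a * b) := by field_simp
      rw [this]
      field_simp
      ring
    rw [this]
    ring
  -- Both polynomials have degree at most `#J` and agree at `0` and at the `#J` points `z w`.
  have hQQ : Q - Q' = 0 := by
    refine eq_zero_of_natDegree_lt_card_of_eval_eq_zero' _ (insert 0 (J.image z)) ?_ ?_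
    · intro u hu
      rw [eval_sub, sub_eq_zero]
      rcases mem_insert.1 hu with rfl | hu
      · exact hzero
      · obtain ⟨w, hw, rfl⟩ := mem_image.1 hu
        exact hpt w hw
    · rw [card_insert_of_notMem, card_image_of_injOn]
      · exact Nat.lt_succ_of_le ((natDegree_sub_le _ _).trans (max_le hQd hQd'))
      · intro x hx y hy hxy
        by_contra hne
        exact hzJ.2 x hx y hy hne hxy
      · intro h
        obtain ⟨w, hw, h⟩ := mem_image.1 h
        exact hzJ.1 w hw h
  have hoJ : o ∉ J := notMem_erase o I
  have hden : ∀ x ∈ J, poleDenom a b (z x) (z o) ≠ 0 := fun x hx =>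
    poleDenom_ne_zero hz ho (hJI.1 hx) (mem_erase.1 hx).1
  have hden' : ∀ x ∈ J, poleDenom a⁻¹ b⁻¹ (z x) (z o) ≠ 0 := fun x hx =>
    poleDenom_ne_zero (hz.inv ha hb) ho (hJI.1 hx) (mem_erase.1 hx).1
  have e1 := hQ (z o)
  have e2 := hQ' (z o)
  rw [clearedSum_eq_halfSum_mul f hden] at e1
  rw [clearedSum_eq_halfSum_mul f hden', ← sub_eq_zero.1 hQQ] at e2
  simp only [poleDenom, prod_mul_distrib, ← mul_assoc] at e1 e2
  have e1 := mul_right_cancel₀ (prod_ne_zero_iff.2 fun x hx => (mul_ne_zero_iff.1 (hden x hx)).2) e1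
  have e2 := mul_right_cancel₀ (prod_ne_zero_iff.2 fun x hx => (mul_ne_zero_iff.1 (hden' x hx)).2) e2
  have e3 := mul_right_cancel₀
    (prod_ne_zero_iff.2 fun x hx => (mul_ne_zero_iff.1 (hden x hx)).1) (e1.trans e2.symm)
  rw [← sub_eq_zero, ← insert_erase ho, splitSum_insert_sub ha hb z hoJ, e3, sub_self]

end ExchangeIdentity

variable {ι : Type*} [Fintype ι] [DecidableEq ι]

/-! ### Inversion of the parameters -/

lemma Generic.swap {q t : ℂ} (h : Generic q t) : Generic t q :=
  ⟨h.2.1, h.1, fun a b e => (h.2.2 b a (by rw [mul_comm]; exact e)).symm⟩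

lemma Generic.inv {q t : ℂ} (h : Generic q t) : Generic q⁻¹ t⁻¹ := by
  refine ⟨inv_ne_zero h.1, inv_ne_zero h.2.1, fun a b e => ?_⟩
  have := h.2.2 (-a) (-b) (by rw [zpow_neg, zpow_neg, ← inv_zpow, ← inv_zpow]; exact e)
  omega

lemma Generic.eq_of_eq {q t : ℂ} (h : Generic q t) {a b c d : ℤ}
    (e : q ^ a * t ^ b = q ^ c * t ^ d) : a = c ∧ b = d := by
  have := h.2.2 (a - c) (b - d) (by
    rw [zpow_sub₀ h.1, zpow_sub₀ h.2.1, div_mul_div_comm, e]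
    exact div_self (mul_ne_zero (zpow_ne_zero _ h.1) (zpow_ne_zero _ h.2.1)))
  omega

lemma etaRatio_inv {q t s : ℂ} (hs : s ≠ 0) :
    etaRatio q⁻¹ t⁻¹ s⁻¹ = etaRatio q t s := by
  unfold etaRatio
  rw [inv_inv, inv_inv, ← mul_div_mul_left _ _ (pow_ne_zero 2 hs)]
  congr 1
  · field_simp
    ring
  · field_simp
    ring

lemma etaRatio_swap {q t s : ℂ} (hs : s ≠ 0) :
    etaRatio t q s = etaRatio q t s⁻¹ := by
  unfold etaRatio
  rw [← mul_div_mul_left ((q - q⁻¹ * s⁻¹) * _) _ (pow_ne_zero 2 hs)]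
  congr 1
  · field_simp
    ring
  · field_simp
    ring

lemma gammaCoeff_inv (g : SimpleCartanDatum ι) {q t : ℂ} (h : Generic q t) (i : ι)
    (X S : Finset (ℤ × ℤ)) : gammaCoeff g q⁻¹ t⁻¹ i X S = gammaCoeff g q t i X S := by
  unfold gammaCoeff
  refine prod_congr rfl fun x _ => prod_congr rfl fun y _ => ?_
  rw [inv_pow, inv_zpow, inv_zpow, ← mul_inv]
  exact etaRatio_inv (mul_ne_zero (zpow_ne_zero _ h.1) (zpow_ne_zero _ h.2.1))

lemma slTwoString_inv (g : SimpleCartanDatum ι) {q t : ℂ} (h : Generic q t) (i : ι)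
    (M : YMonomial ι) : slTwoString g q⁻¹ t⁻¹ i M = slTwoString g q t i M := by
  simp only [slTwoString, gammaCoeff_inv g h]

lemma isPasted_inv_iff (g : SimpleCartanDatum ι) {q t : ℂ} (h : Generic q t)
    (T : YMonomial ι →₀ ℂ) : IsPasted g q⁻¹ t⁻¹ T ↔ IsPasted g q t T := by
  simp only [IsPasted, slTwoString_inv g h]

theorem IsGenerator.coeff_inv {g : SimpleCartanDatum ι} {i : ι} {mult : (ι → ℤ) →₀ ℕ}
    {R : (lam : ι → ℤ) → Fin (mult lam) → Multiset (ι × ℤ × ℤ)}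
    {c : ℂ → ℂ → (lam : ι → ℤ) → Fin (mult lam) → ℂ} (hc : IsGenerator g i mult R c)
    {q t : ℂ} (h : Generic q t) : c q⁻¹ t⁻¹ = c q t :=
  hc.unique q t h _ (hc.normalized _ _ h.inv) ((isPasted_inv_iff g h _).1 (hc.pasted _ _ h.inv))

/-! ### Reflection symmetry of the `sl₂` strings -/

/-- The factor `q^a t^b` of the argument of `Y_j(z q^a t^b)`. -/
def argument (q t : ℂ) (x : ℤ × ℤ) : ℂ := q ^ x.1 * t ^ x.2

lemma argument_ne_zero {q t : ℂ} (h : Generic q t) (x : ℤ × ℤ) : argument q t x ≠ 0 :=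
  mul_ne_zero (zpow_ne_zero _ h.1) (zpow_ne_zero _ h.2.1)

lemma argument_sub {q t : ℂ} (h : Generic q t) (x y : ℤ × ℤ) :
    q ^ (x.1 - y.1) * t ^ (x.2 - y.2) = argument q t x / argument q t y := by
  rw [argument, argument, zpow_sub₀ h.1, zpow_sub₀ h.2.1, div_mul_div_comm]

lemma etaRatio_div {q t : ℂ} (hq : q ≠ 0) (ht : t ≠ 0) {x y : ℂ} (hy : y ≠ 0) :
    etaRatio q t (x / y) = exchangeKernel (q ^ 2)⁻¹ (t ^ 2) x y := by
  unfold etaRatio exchangeKernel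
  rw [← mul_div_mul_left _ _ (mul_ne_zero (mul_ne_zero (inv_ne_zero hq) ht) (pow_ne_zero 2 hy))]
  congr 1
  · field_simp
  · field_simp

lemma gammaCoeff_eq_splitProd (g : SimpleCartanDatum ι) {q t : ℂ} (h : Generic q t) (i : ι)
    (X S : Finset (ℤ × ℤ)) :
    gammaCoeff g q t i X S =
      splitProd (pointKernel ((q ^ g.r i) ^ 2)⁻¹ (t ^ 2) (argument q t)) X S := by
  unfold gammaCoeff splitProd pointKernel
  refine prod_congr rfl fun x _ => prod_congr rfl fun y _ => ?_
  rw [argument_sub h, etaRatio_div (pow_ne_zero _ h.1) h.2.1 (argument_ne_zero h y)]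

lemma admissible_positions (g : SimpleCartanDatum ι) {q t : ℂ} (h : Generic q t) {i : ι}
    {M : YMonomial ι} (hM : IsTop g i M) :
    Admissible ((q ^ g.r i) ^ 2)⁻¹ (t ^ 2) (argument q t) (positions i M) := by
  refine ⟨fun x _ => argument_ne_zero h x, fun x _ y _ hxy e => hxy ?_, fun x hx y hy e => ?_⟩
  · obtain ⟨h1, h2⟩ := h.eq_of_eq e
    exact Prod.ext h1 h2
  · refine hM.2 x hx y hy ?_
    have e1 : ((q ^ g.r i) ^ 2)⁻¹ * t ^ 2 * argument q t x =
        q ^ (x.1 - 2 * (g.r i : ℤ)) * t ^ (x.2 + 2) := by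
      rw [argument, zpow_sub₀ h.1, zpow_add₀ h.2.1, mul_comm 2, zpow_mul, zpow_natCast]
      norm_cast
      field_simp
    rw [e1] at e
    obtain ⟨h1, h2⟩ := h.eq_of_eq e
    omega

/-- The coefficients `γ_S` of an `sl₂` string have the same sum over the subsets `S` of size `k` as
over those of size `n - k`. -/
theorem sum_gammaCoeff_compl (g : SimpleCartanDatum ι) {q t : ℂ} (h : Generic q t) {i : ι}
    {M : YMonomial ι} (hM : IsTop g i M) (f : ℕ → ℂ) :
    ∑ S ∈ (positions i M).powerset, f #(positions i M \ S) * gammaCoeff g q t i (positions i M) S =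
      ∑ S ∈ (positions i M).powerset, f #S * gammaCoeff g q t i (positions i M) S := by
  have ha : ((q ^ g.r i) ^ 2)⁻¹ ≠ 0 := inv_ne_zero (pow_ne_zero _ (pow_ne_zero _ h.1))
  have hb : t ^ 2 ≠ 0 := pow_ne_zero _ h.2.1
  have key := splitSum_inv ha hb (positions i M) (admissible_positions g h hM) f
  simp only [gammaCoeff_eq_splitProd g h]
  refine Eq.trans ?_ key.symm
  refine sum_nbij' (fun S => positions i M \ S) (fun S => positions i M \ S) ?_ ?_ ?_ ?_ ?_
  · exact fun S _ => mem_powerset.2 sdiff_subset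
  · exact fun S _ => mem_powerset.2 sdiff_subset
  · exact fun S hS => Finset.sdiff_sdiff_eq_self (mem_powerset.1 hS)
  · exact fun S hS => Finset.sdiff_sdiff_eq_self (mem_powerset.1 hS)
  · intro S hS
    congr 1
    unfold splitProd
    rw [prod_comm, Finset.sdiff_sdiff_eq_self (mem_powerset.1 hS)]
    simp only [pointKernel_inv ha hb]

/-- The weight of a normally ordered monomial, in which each factor `Y_j(z q^a t^b)` has weight
`ω_j`. -/
def monomialWeight : YMonomial ι →+ (ι → ℤ) :=
  Finsupp.liftAddHom fun x => AddMonoidHom.single (fun _ => ℤ) x.1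

lemma monomialWeight_single {κ : Type*} [DecidableEq κ] (x : κ × ℤ × ℤ) (n : ℤ) :
    monomialWeight (Finsupp.single x n) = Pi.single x.1 n := by
  simp [monomialWeight]

lemma monomialWeight_aMonomial (g : SimpleCartanDatum ι) (i : ι) (a b : ℤ) :
    monomialWeight (aMonomial g i a b) = g.simpleRoot i := by
  unfold aMonomial SimpleCartanDatum.simpleRoot
  simp only [map_sub, map_add, map_sum, monomialWeight_single]
  ext j
  simp only [sum_const, card_range, Pi.sub_apply, Pi.add_apply, Finset.sum_apply, Pi.smul_apply]
  by_cases hj : j = i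
  · subst hj
    rw [sum_eq_zero]
    · simp [g.diag]
    · intro k hk
      rw [Pi.single_eq_of_ne (mem_erase.1 hk).1.symm, smul_zero]
  · rw [sum_eq_single j]
    · have := g.offDiag j i hj
      rw [Pi.single_eq_same, Pi.single_eq_of_ne hj]
      simp
      omega
    · intro k _ hk
      rw [Pi.single_eq_of_ne hk.symm, smul_zero]
    · intro h
      exact absurd (mem_erase.2 ⟨hj, mem_univ j⟩) h

lemma monomialWeight_termMonomial (g : SimpleCartanDatum ι) (i : ι) (R : Multiset (ι × ℤ × ℤ)) :
    monomialWeight (termMonomial g i R) = g.fundWeight i - (R.map fun x => g.simpleRoot x.1).sum := by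
  unfold termMonomial SimpleCartanDatum.fundWeight
  rw [map_sub, monomialWeight_single, map_multiset_sum, Multiset.map_map]
  simp only [Function.comp_def, monomialWeight_aMonomial]

lemma monomialWeight_apply_of_isTop {g : SimpleCartanDatum ι} {i : ι} {M : YMonomial ι}
    (hM : IsTop g i M) : monomialWeight M i = #(positions i M) := by
  unfold positions
  rw [card_image_of_injOn]
  · simp only [monomialWeight, Finsupp.liftAddHom_apply, Finsupp.sum, Finset.sum_apply,
      AddMonoidHom.single_apply, card_eq_sum_ones, Nat.cast_sum, Nat.cast_one]
    rw [sum_filter]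
    refine sum_congr rfl fun x hx => ?_
    split_ifs with h
    · obtain ⟨j, x⟩ := x
      subst h
      rw [Pi.single_eq_same]
      exact (hM.1 x).resolve_left (Finsupp.mem_support_iff.1 hx)
    · exact Pi.single_eq_of_ne (Ne.symm h) _
  · intro x hx y hy hxy
    have h1 := (mem_filter.1 hx).2
    have h2 := (mem_filter.1 hy).2
    exact Prod.ext (h1.trans h2.symm) hxy

lemma monomialWeight_sub_sum_aMonomial (g : SimpleCartanDatum ι) (i : ι) (M : YMonomial ι)
    (S : Finset (ℤ × ℤ)) :
    monomialWeight (M - ∑ x ∈ S, aMonomial g i (x.1 - g.r i) (x.2 + 1)) =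
      monomialWeight M - (#S : ℤ) • g.simpleRoot i := by
  simp only [map_sub, map_sum, monomialWeight_aMonomial, sum_const, natCast_zsmul]

/-- The sum of the coefficients of the monomials of weight `lam`. -/
def weightCoeff (lam : ι → ℤ) : (YMonomial ι →₀ ℂ) →ₗ[ℂ] ℂ :=
  Finsupp.linearCombination ℂ fun M => if monomialWeight M = lam then 1 else 0

lemma weightCoeff_slTwoString (g : SimpleCartanDatum ι) (q t : ℂ) (i : ι) (M : YMonomial ι)
    (lam : ι → ℤ) :
    weightCoeff lam (slTwoString g q t i M) = ∑ S ∈ (positions i M).powerset,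
      (if monomialWeight M - (#S : ℤ) • g.simpleRoot i = lam then 1 else 0) *
        gammaCoeff g q t i (positions i M) S := by
  simp only [weightCoeff, slTwoString, map_sum, Finsupp.linearCombination_single,
    monomialWeight_sub_sum_aMonomial, smul_eq_mul, mul_comm]

lemma SimpleCartanDatum.simpleReflection_apply (g : SimpleCartanDatum ι) (i : ι) (lam : ι → ℤ) :
    g.simpleReflection i lam = lam - lam i • g.simpleRoot i := rfl

lemma sub_smul_eq_simpleReflection_iff (g : SimpleCartanDatum ι) (i : ι) (mu lam : ι → ℤ) (k : ℤ) :
    mu - k • g.simpleRoot i = g.simpleReflection i lam ↔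
      mu - (mu i - k) • g.simpleRoot i = lam := by
  have hinv : ∀ nu, g.simpleReflection i (g.simpleReflection i nu) = nu :=
    Module.involutive_reflection (x := g.simpleRoot i) (f := LinearMap.proj i) (g.diag i)
  have key : g.simpleReflection i (mu - k • g.simpleRoot i) =
      mu - (mu i - k) • g.simpleRoot i := by
    rw [g.simpleReflection_apply]
    have : (mu - k • g.simpleRoot i) i = mu i - 2 * k := by
      simp [SimpleCartanDatum.simpleRoot, g.diag, mul_comm]
    rw [this]
    module
  rw [← key]
  constructor
  · intro h
    rw [h, hinv]
  · rintro rfl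
    rw [hinv]

lemma weightCoeff_slTwoString_reflection (g : SimpleCartanDatum ι) {q t : ℂ} (h : Generic q t)
    {i : ι} {M : YMonomial ι} (hM : IsTop g i M) (lam : ι → ℤ) :
    weightCoeff (g.simpleReflection i lam) (slTwoString g q t i M) =
      weightCoeff lam (slTwoString g q t i M) := by
  rw [weightCoeff_slTwoString, weightCoeff_slTwoString, ← sum_gammaCoeff_compl g h hM
    (fun n => if monomialWeight M - (n : ℤ) • g.simpleRoot i = lam then 1 else 0)]
  refine sum_congr rfl fun S hS => ?_
  have hcard : ((#(positions i M \ S) : ℕ) : ℤ) = monomialWeight M i - #S := by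
    rw [monomialWeight_apply_of_isTop hM, card_sdiff_of_subset (mem_powerset.1 hS),
      Nat.cast_sub (card_le_card (mem_powerset.1 hS))]
  simp only [sub_smul_eq_simpleReflection_iff, hcard]

lemma IsPasted.weightCoeff_reflection {g : SimpleCartanDatum ι} {q t : ℂ} (h : Generic q t)
    {T : YMonomial ι →₀ ℂ} (hT : IsPasted g q t T) (i : ι) (lam : ι → ℤ) :
    weightCoeff (g.simpleReflection i lam) T = weightCoeff lam T := by
  refine LinearMap.eqOn_span' ?_ (hT i)
  rintro B ⟨M, hM, rfl⟩
  exact weightCoeff_slTwoString_reflection g h hM lam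

lemma IsPasted.weightCoeff_weylGroup {g : SimpleCartanDatum ι} {q t : ℂ} (h : Generic q t)
    {T : YMonomial ι →₀ ℂ} (hT : IsPasted g q t T) {w : (ι → ℤ) ≃ₗ[ℤ] (ι → ℤ)}
    (hw : w ∈ g.weylGroup) (lam : ι → ℤ) : weightCoeff (w lam) T = weightCoeff lam T := by
  induction hw using Subgroup.closure_induction generalizing lam with
  | mem w hw =>
    obtain ⟨i, rfl⟩ := hw
    exact hT.weightCoeff_reflection h i lam
  | one => rfl
  | mul v w _ _ hv hw => rw [LinearEquiv.mul_apply, hv, hw]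
  | inv w _ hw => rw [← hw, ← LinearEquiv.mul_apply, mul_inv_cancel]; rfl

lemma IsGenerator.monomialWeight_termMonomial {g : SimpleCartanDatum ι} {i : ι} {mult : (ι → ℤ) →₀ ℕ}
    {R : (lam : ι → ℤ) → Fin (mult lam) → Multiset (ι × ℤ × ℤ)}
    {c : ℂ → ℂ → (lam : ι → ℤ) → Fin (mult lam) → ℂ} (hc : IsGenerator g i mult R c)
    (lam : ι → ℤ) (k : Fin (mult lam)) : monomialWeight (termMonomial g i (R lam k)) = lam := by
  rw [DeformedW.monomialWeight_termMonomial, ← hc.weight]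

lemma IsGenerator.weightCoeff_generatorSum {g : SimpleCartanDatum ι} {i : ι}
    {mult : (ι → ℤ) →₀ ℕ} {R : (lam : ι → ℤ) → Fin (mult lam) → Multiset (ι × ℤ × ℤ)}
    {c : ℂ → ℂ → (lam : ι → ℤ) → Fin (mult lam) → ℂ} (hc : IsGenerator g i mult R c)
    (c' : (lam : ι → ℤ) → Fin (mult lam) → ℂ) (lam : ι → ℤ) :
    weightCoeff lam (generatorSum g i mult R c') = ∑ k, c' lam k := by
  simp only [weightCoeff, generatorSum, map_sum, Finsupp.linearCombination_single,
    hc.monomialWeight_termMonomial, smul_eq_mul, mul_ite, mul_one, mul_zero]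
  rw [sum_eq_single lam]
  · simp
  · intro mu _ hmu
    simp [hmu]
  · intro hlam
    have : IsEmpty (Fin (mult lam)) := by
      rw [Finsupp.notMem_support_iff.1 hlam]
      infer_instance
    simp

theorem IsGenerator.sum_coeff_weylGroup {g : SimpleCartanDatum ι} {i : ι}
    {mult : (ι → ℤ) →₀ ℕ} {R : (lam : ι → ℤ) → Fin (mult lam) → Multiset (ι × ℤ × ℤ)}
    {c : ℂ → ℂ → (lam : ι → ℤ) → Fin (mult lam) → ℂ} (hc : IsGenerator g i mult R c)
    {q t : ℂ} (h : Generic q t) {w : (ι → ℤ) ≃ₗ[ℤ] (ι → ℤ)} (hw : w ∈ g.weylGroup)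
    (lam : ι → ℤ) : ∑ k, c q t (w lam) k = ∑ k, c q t lam k := by
  rw [← hc.weightCoeff_generatorSum, ← hc.weightCoeff_generatorSum]
  exact (hc.pasted q t h).weightCoeff_weylGroup h hw lam

/-! ### Simply-laced data and the diagonal part of a generator -/

lemma SimpleCartanDatum.r_pos (g : SimpleCartanDatum ι) (i : ι) : 0 < g.r i := by
  have h := g.posDef (Pi.single i 1) (by simp)
  rw [sum_eq_single i, sum_eq_single i] at h
  · simp only [Pi.single_eq_same, g.diag] at h
    rw [Nat.pos_iff_ne_zero]
    intro h0
    simp [h0] at h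
  · intro j _ hj
    simp [hj]
  · simp
  · intro j _ hj
    simp [hj]
  · simp

lemma SimpleCartanDatum.r_eq_one (g : SimpleCartanDatum ι) (hC : g.C.IsSimplyLaced) (i : ι) :
    g.r i = 1 := by
  have hS : (univ.filter fun j => g.r j = g.r i) = univ := by
    refine g.indecomposable _ ⟨i, by simp⟩ fun j hj k hk => ?_
    simp only [mem_filter, mem_univ, true_and] at hj hk
    have hjk : j ≠ k := fun h => hk (h ▸ hj)
    refine (hC hjk).resolve_right fun h => ?_
    have hsymm := g.symm j k
    have hpos := g.r_pos j
    rcases hC hjk.symm with h' | h' <;> rw [h, h'] at hsymm <;> omega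
  have hdvd : g.r i ∣ univ.gcd g.r := dvd_gcd fun j _ => by
    rw [(mem_filter.1 (hS.symm.le (mem_univ j))).2]
  rw [g.coprime] at hdvd
  exact Nat.dvd_one.1 hdvd

lemma aMonomial_of_isSimplyLaced (g : SimpleCartanDatum ι) (hC : g.C.IsSimplyLaced) (i : ι)
    (a b : ℤ) :
    aMonomial g i a b = Finsupp.single (i, a + 1, b - 1) 1 + Finsupp.single (i, a - 1, b + 1) 1
      - ∑ j ∈ univ.erase i, Finsupp.single (j, a, b) (-g.C j i) := by
  unfold aMonomial
  rw [g.r_eq_one hC, Nat.cast_one]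
  congr 1
  refine sum_congr rfl fun j hj => ?_
  rcases hC (mem_erase.1 hj).1 with h | h
  · simp [h]
  · simp [h]

/-- A sum of simple roots vanishes only if it is empty, as the Cartan matrix is nondegenerate. -/
lemma sum_simpleRoot_eq_zero (g : SimpleCartanDatum ι) {R : Multiset (ι × ℤ × ℤ)}
    (h : (R.map fun x => g.simpleRoot x.1).sum = 0) : R = 0 := by
  -- `v j` is the number of triples in `R` with first entry `j`.
  set v : ι → ℤ := (R.map fun x => Pi.single x.1 1).sum with hv
  have hCv : g.C.mulVec v = 0 := by
    rw [← h, hv, ← Matrix.mulVecLin_apply, map_multiset_sum, Multiset.map_map]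
    congr 1
    refine Multiset.map_congr rfl fun x _ => ?_
    ext j
    simp [SimpleCartanDatum.simpleRoot]
  have hv0 : v = 0 := by
    by_contra hne
    have hpos := g.posDef (fun i => (v i : ℝ)) fun h0 => hne (funext fun i => by
      simpa using congrFun h0 i)
    have hz : ∀ i, ∑ j, (v i : ℝ) * ((g.r i : ℝ) * (g.C i j : ℝ)) * v j = 0 := by
      intro i
      have := congrFun hCv i
      simp only [Matrix.mulVec, dotProduct, Pi.zero_apply] at this
      have : ∑ j, (g.C i j : ℝ) * v j = 0 := by exact_mod_cast this
      simp only [mul_assoc, ← mul_sum, this, mul_zero]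
    simp [hz] at hpos
  have hcard : ((Multiset.card R : ℕ) : ℤ) = ∑ j, v j := by
    rw [hv]
    clear_value v
    clear h hv hCv hv0
    induction R using Multiset.induction with
    | empty => simp
    | cons x R ih => simp [sum_add_distrib, ih, add_comm]
  rw [hv0] at hcard
  simpa using hcard

/-- The part of a monomial consisting of the factors `Y_j(z q^a t^b)` with `a + b ≠ 0`. -/
def offDiagonal : YMonomial ι →+ YMonomial ι :=
  Finsupp.filterAddHom fun x => x.2.1 + x.2.2 ≠ 0

lemma offDiagonal_single {κ : Type*} (x : κ × ℤ × ℤ) (n : ℤ) :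
    offDiagonal (Finsupp.single x n) =
      if x.2.1 + x.2.2 ≠ 0 then Finsupp.single x n else 0 := by
  split_ifs with h
  · exact Finsupp.filter_single_of_pos _ h
  · exact Finsupp.filter_single_of_neg _ h

lemma offDiagonal_aMonomial (g : SimpleCartanDatum ι) (hC : g.C.IsSimplyLaced) (i : ι) (a b : ℤ) :
    offDiagonal (aMonomial g i a b) = if a + b ≠ 0 then aMonomial g i a b else 0 := by
  rw [aMonomial_of_isSimplyLaced g hC]
  simp only [map_sub, map_add, map_sum, offDiagonal_single, add_add_sub_cancel,
    show a - 1 + (b + 1) = a + b by ring]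
  split_ifs <;> simp

lemma apply_eq_zero_of_offDiagonal {κ : Type*} {M : YMonomial κ} (hM : offDiagonal M = 0)
    {x : κ × ℤ × ℤ}
    (hx : x.2.1 + x.2.2 ≠ 0) : M x = 0 :=
  (Finsupp.filter_eq_zero_iff (fun x : κ × ℤ × ℤ => x.2.1 + x.2.2 ≠ 0) M).1 hM x hx

/-- The exponent of the product of the fields `A_j(z q^a t^b)` over the triples `(j, a, b)`
in `R`. -/
def loweringSum (g : SimpleCartanDatum ι) (R : Multiset (ι × ℤ × ℤ)) : YMonomial ι :=
  (R.map fun x => aMonomial g x.1 x.2.1 x.2.2).sum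

lemma loweringSum_eq_zero {g : SimpleCartanDatum ι} {R : Multiset (ι × ℤ × ℤ)}
    (h : loweringSum g R = 0) : R = 0 := by
  apply sum_simpleRoot_eq_zero g
  have := congrArg monomialWeight h
  rw [loweringSum, map_multiset_sum, Multiset.map_map, map_zero] at this
  simpa only [Function.comp_def, monomialWeight_aMonomial] using this

/-- The off-diagonal part of `M` is a product of inverses of fields `A_j(z q^a t^b)`. -/
def OffDiagonalLowered (g : SimpleCartanDatum ι) (M : YMonomial ι) : Prop :=
  ∃ R, offDiagonal M = -loweringSum g R

lemma OffDiagonalLowered.termMonomial (g : SimpleCartanDatum ι) (hC : g.C.IsSimplyLaced) (i : ι)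
    (R : Multiset (ι × ℤ × ℤ)) : OffDiagonalLowered g (termMonomial g i R) := by
  refine ⟨R.filter fun x => x.2.1 + x.2.2 ≠ 0, ?_⟩
  unfold DeformedW.termMonomial loweringSum
  rw [map_sub, offDiagonal_single, if_neg (by simp), zero_sub, map_multiset_sum, Multiset.map_map]
  congr 1
  simp only [Function.comp_def, offDiagonal_aMonomial g hC]
  induction R using Multiset.induction with
  | empty => simp
  | cons x R ih =>
    by_cases hx : x.2.1 + x.2.2 ≠ 0
    · rw [Multiset.filter_cons_of_pos (p := fun x : ι × ℤ × ℤ => x.2.1 + x.2.2 ≠ 0) R hx]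
      simp only [Multiset.map_cons, Multiset.sum_cons, ih, if_pos hx]
    · rw [Multiset.filter_cons_of_neg (p := fun x : ι × ℤ × ℤ => x.2.1 + x.2.2 ≠ 0) R hx]
      simp only [Multiset.map_cons, Multiset.sum_cons, ih, if_neg hx, zero_add]

/-- The second claim holds because no non-empty product of fields `A_j` is trivial, so that a further
factor cannot cancel the off-diagonal part. -/
lemma OffDiagonalLowered.sub_aMonomial {g : SimpleCartanDatum ι} (hC : g.C.IsSimplyLaced)
    {M : YMonomial ι} (hM : OffDiagonalLowered g M) (i : ι) (a b : ℤ) :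
    OffDiagonalLowered g (M - aMonomial g i a b) ∧
      (offDiagonal M ≠ 0 → offDiagonal (M - aMonomial g i a b) ≠ 0) := by
  obtain ⟨R, hR⟩ := hM
  by_cases hab : a + b ≠ 0
  · have e : offDiagonal (M - aMonomial g i a b) = -loweringSum g ((i, a, b) ::ₘ R) := by
      rw [map_sub, hR, offDiagonal_aMonomial g hC, if_pos hab, loweringSum, loweringSum,
        Multiset.map_cons, Multiset.sum_cons]
      abel
    refine ⟨⟨_, e⟩, fun _ h0 => ?_⟩
    rw [e, neg_eq_zero] at h0
    exact Multiset.cons_ne_zero (loweringSum_eq_zero h0)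
  · have e : offDiagonal (M - aMonomial g i a b) = offDiagonal M := by
      rw [map_sub, offDiagonal_aMonomial g hC, if_neg hab, sub_zero]
    rw [e]
    exact ⟨⟨R, by rw [e, hR]⟩, id⟩

lemma OffDiagonalLowered.sub_sum {g : SimpleCartanDatum ι} (hC : g.C.IsSimplyLaced)
    {M : YMonomial ι} (hM : OffDiagonalLowered g M) (i : ι) (S : Finset (ℤ × ℤ)) :
    OffDiagonalLowered g (M - ∑ x ∈ S, aMonomial g i (x.1 - g.r i) (x.2 + 1)) ∧
      (offDiagonal M ≠ 0 →
        offDiagonal (M - ∑ x ∈ S, aMonomial g i (x.1 - g.r i) (x.2 + 1)) ≠ 0) := by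
  induction S using Finset.induction with
  | empty => simpa using hM
  | insert x S hx ih =>
    rw [sum_insert hx, add_comm, ← sub_sub]
    have := ih.1.sub_aMonomial hC i (x.1 - g.r i) (x.2 + 1)
    exact ⟨this.1, fun h => this.2 (ih.2 h)⟩

lemma offDiagonal_sub_sum_eq_zero {g : SimpleCartanDatum ι} (hC : g.C.IsSimplyLaced)
    {M : YMonomial ι} (hM : offDiagonal M = 0) {i : ι} {S : Finset (ℤ × ℤ)}
    (hS : S ⊆ positions i M) :
    offDiagonal (M - ∑ x ∈ S, aMonomial g i (x.1 - g.r i) (x.2 + 1)) = 0 := by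
  rw [map_sub, hM, map_sum, sum_eq_zero, sub_zero]
  intro x hx
  obtain ⟨y, hy, rfl⟩ := mem_image.1 (hS hx)
  rw [offDiagonal_aMonomial g hC, g.r_eq_one hC, if_neg]
  have h : y.2.1 + y.2.2 = 0 := by
    by_contra h
    exact Finsupp.mem_support_iff.1 (mem_filter.1 hy).1 (apply_eq_zero_of_offDiagonal hM h)
  rw [not_not, Nat.cast_one]
  omega

lemma exists_of_slTwoString_apply_ne_zero {g : SimpleCartanDatum ι} {q t : ℂ} {i : ι}
    {M N : YMonomial ι} (h : slTwoString g q t i M N ≠ 0) :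
    ∃ S ⊆ positions i M, N = M - ∑ x ∈ S, aMonomial g i (x.1 - g.r i) (x.2 + 1) := by
  rw [slTwoString, Finsupp.finsetSum_apply] at h
  obtain ⟨S, hS, h⟩ := exists_ne_zero_of_sum_ne_zero h
  refine ⟨S, mem_powerset.1 hS, ?_⟩
  by_contra hne
  exact h (Finsupp.single_eq_of_ne hne)

lemma slTwoString_apply_self (g : SimpleCartanDatum ι) (q t : ℂ) (i : ι) (M : YMonomial ι) :
    slTwoString g q t i M M = 1 := by
  rw [slTwoString, Finsupp.finsetSum_apply, sum_eq_single ∅]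
  · simp [gammaCoeff]
  · intro S _ hS
    refine Finsupp.single_eq_of_ne fun h => ?_
    have h1 := congrFun (congrArg monomialWeight h) i
    rw [monomialWeight_sub_sum_aMonomial] at h1
    simp only [SimpleCartanDatum.simpleRoot, Pi.sub_apply, Pi.smul_apply, g.diag,
      smul_eq_mul] at h1
    exact hS (card_eq_zero.1 (by omega))
  · simp

lemma monomialWeight_lt_of_slTwoString_apply_ne_zero {g : SimpleCartanDatum ι} {q t : ℂ} {i : ι}
    {M N : YMonomial ι} (h : slTwoString g q t i M N ≠ 0) (hne : N ≠ M) :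
    monomialWeight N i < monomialWeight M i := by
  obtain ⟨S, -, rfl⟩ := exists_of_slTwoString_apply_ne_zero h
  rw [monomialWeight_sub_sum_aMonomial]
  have : 0 < #S := card_pos.2 (nonempty_iff_ne_empty.2 fun h0 => hne (by simp [h0]))
  simp only [SimpleCartanDatum.simpleRoot, Pi.sub_apply, Pi.smul_apply, g.diag, smul_eq_mul]
  omega

/-- The projection that keeps the monomials without off-diagonal part. -/
def diagonalPart : (YMonomial ι →₀ ℂ) →ₗ[ℂ] (YMonomial ι →₀ ℂ) :=
  Finsupp.linearCombination ℂ fun M => if offDiagonal M = 0 then Finsupp.single M 1 else 0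

lemma diagonalPart_single {κ : Type*} [DecidableEq κ] (M : YMonomial κ) (c : ℂ) :
    diagonalPart (Finsupp.single M c) = if offDiagonal M = 0 then Finsupp.single M c else 0 := by
  rw [diagonalPart, Finsupp.linearCombination_single]
  split_ifs <;> simp

lemma diagonalPart_slTwoString {g : SimpleCartanDatum ι} (hC : g.C.IsSimplyLaced) (q t : ℂ)
    (i : ι) {M : YMonomial ι} (hM : OffDiagonalLowered g M) :
    diagonalPart (slTwoString g q t i M) =
      if offDiagonal M = 0 then slTwoString g q t i M else 0 := by
  unfold slTwoString
  simp only [map_sum, diagonalPart_single]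
  split_ifs with h
  · exact sum_congr rfl fun S hS =>
      if_pos (offDiagonal_sub_sum_eq_zero hC h (mem_powerset.1 hS))
  · exact sum_eq_zero fun S _ => if_neg ((hM.sub_sum hC i S).2 h)

/-- Triangularity: if only monomials with `OffDiagonalLowered` occur in a combination of strings,
then only strings with such a highest component are used. -/
lemma offDiagonalLowered_of_mem_support {g : SimpleCartanDatum ι} (hC : g.C.IsSimplyLaced)
    {q t : ℂ} {i : ι} {l : YMonomial ι →₀ ℂ}
    (h : ∀ N, Finsupp.linearCombination ℂ (slTwoString g q t i) l N ≠ 0 → OffDiagonalLowered g N)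
    {M : YMonomial ι} (hM : M ∈ l.support) : OffDiagonalLowered g M := by
  classical
  by_contra hbad
  -- The `i`-weight drops by `2` with every lowering, so a bad highest component of maximal weight
  -- occurs in no other string with a bad highest component; nor does it occur in one with a good
  -- highest component, as lowering preserves `OffDiagonalLowered`.
  obtain ⟨N, hN, hmax⟩ := exists_max_image (l.support.filter fun M => ¬ OffDiagonalLowered g M)
    (fun M => monomialWeight M i) ⟨M, mem_filter.2 ⟨hM, hbad⟩⟩
  obtain ⟨hNl, hNbad⟩ := mem_filter.1 hN
  refine hNbad (h N ?_)
  rw [Finsupp.linearCombination_apply, Finsupp.sum, Finsupp.finsetSum_apply, sum_eq_single N]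
  · rw [Finsupp.smul_apply, slTwoString_apply_self, smul_eq_mul, mul_one]
    exact Finsupp.mem_support_iff.1 hNl
  · intro M' hM' hne
    rw [Finsupp.smul_apply, smul_eq_mul, mul_eq_zero]
    right
    by_contra hE
    have hlt := monomialWeight_lt_of_slTwoString_apply_ne_zero hE hne.symm
    refine absurd (hmax M' (mem_filter.2 ⟨hM', fun hgood => hNbad ?_⟩)) (not_le.2 hlt)
    obtain ⟨S, -, rfl⟩ := exists_of_slTwoString_apply_ne_zero hE
    exact (hgood.sub_sum hC i S).1
  · exact fun h => absurd hNl h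

lemma IsPasted.diagonalPart {g : SimpleCartanDatum ι} (hC : g.C.IsSimplyLaced) {q t : ℂ}
    {T : YMonomial ι →₀ ℂ} (hT : IsPasted g q t T)
    (hlow : ∀ N, T N ≠ 0 → OffDiagonalLowered g N) : IsPasted g q t (diagonalPart T) := by
  intro i
  have hset : {B | ∃ M, IsTop g i M ∧ B = slTwoString g q t i M} =
      slTwoString g q t i '' {M | IsTop g i M} := by
    ext B
    simp only [Set.mem_ofPred_eq, Set.mem_image, eq_comm]
  have hTi := hT i
  rw [hset, Finsupp.mem_span_image_iff_linearCombination] at hTi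
  obtain ⟨l, hl, rfl⟩ := hTi
  rw [Finsupp.linearCombination_apply, Finsupp.sum, map_sum]
  refine Submodule.sum_mem _ fun M hM => ?_
  rw [map_smul, diagonalPart_slTwoString hC q t i (offDiagonalLowered_of_mem_support hC hlow hM)]
  refine Submodule.smul_mem _ _ ?_
  split_ifs
  · exact Submodule.subset_span ⟨M, hl hM, rfl⟩
  · exact Submodule.zero_mem _

lemma generatorSum_apply_ne_zero {g : SimpleCartanDatum ι} {i : ι} {mult : (ι → ℤ) →₀ ℕ}
    {R : (lam : ι → ℤ) → Fin (mult lam) → Multiset (ι × ℤ × ℤ)}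
    {c : (lam : ι → ℤ) → Fin (mult lam) → ℂ} {N : YMonomial ι}
    (h : generatorSum g i mult R c N ≠ 0) : ∃ lam k, N = termMonomial g i (R lam k) := by
  rw [generatorSum, Finsupp.finsetSum_apply] at h
  obtain ⟨lam, -, h⟩ := exists_ne_zero_of_sum_ne_zero h
  rw [Finsupp.finsetSum_apply] at h
  obtain ⟨k, -, h⟩ := exists_ne_zero_of_sum_ne_zero h
  refine ⟨lam, k, ?_⟩
  by_contra hne
  exact h (Finsupp.single_eq_of_ne hne)

lemma IsGenerator.termMonomial_highest {g : SimpleCartanDatum ι} {i : ι} {mult : (ι → ℤ) →₀ ℕ}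
    {R : (lam : ι → ℤ) → Fin (mult lam) → Multiset (ι × ℤ × ℤ)}
    {c : ℂ → ℂ → (lam : ι → ℤ) → Fin (mult lam) → ℂ} (hc : IsGenerator g i mult R c)
    (k : Fin (mult (g.fundWeight i))) :
    termMonomial g i (R (g.fundWeight i) k) = Finsupp.single (i, 0, 0) 1 := by
  have h := hc.weight _ k
  rw [eq_comm, sub_eq_self] at h
  rw [sum_simpleRoot_eq_zero g h]
  simp [termMonomial]

lemma IsGenerator.diagonalPart_generatorSum {g : SimpleCartanDatum ι} (hC : g.C.IsSimplyLaced)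
    {i : ι} {mult : (ι → ℤ) →₀ ℕ} {R : (lam : ι → ℤ) → Fin (mult lam) → Multiset (ι × ℤ × ℤ)}
    {c : ℂ → ℂ → (lam : ι → ℤ) → Fin (mult lam) → ℂ} (hc : IsGenerator g i mult R c)
    {q t : ℂ} (h : Generic q t) :
    diagonalPart (generatorSum g i mult R (c q t)) = generatorSum g i mult R (c q t) := by
  have e : diagonalPart (generatorSum g i mult R (c q t)) = generatorSum g i mult R
      fun lam k => if offDiagonal (termMonomial g i (R lam k)) = 0 then c q t lam k else 0 := by
    unfold generatorSum
    simp only [map_sum, diagonalPart_single]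
    refine sum_congr rfl fun lam _ => sum_congr rfl fun k _ => ?_
    split_ifs <;> simp
  rw [e]
  congr 1
  refine hc.unique q t h _ (fun k => ?_) ?_
  · rw [hc.termMonomial_highest, if_pos (by simp [offDiagonal_single]), hc.normalized q t h]
  · rw [← e]
    refine (hc.pasted q t h).diagonalPart hC fun N hN => ?_
    obtain ⟨lam, k, rfl⟩ := generatorSum_apply_ne_zero hN
    exact OffDiagonalLowered.termMonomial g hC i _

/-! ### Exchange of the parameters -/

/-- The map `q^a t^b ↦ q^{-b} t^{-a}` of arguments: inversion together with the exchange of `q`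
and `t`. -/
def argumentFlip : ℤ × ℤ ≃ ℤ × ℤ where
  toFun x := (-x.2, -x.1)
  invFun x := (-x.2, -x.1)
  left_inv x := by simp
  right_inv x := by simp

/-- The effect of `argumentFlip` on the exponents of monomials. -/
def monomialFlip {κ : Type*} : YMonomial κ ≃+ YMonomial κ :=
  Finsupp.domCongr ((Equiv.refl κ).prodCongr argumentFlip)

lemma monomialFlip_single {κ : Type*} (i : κ) (a b n : ℤ) :
    monomialFlip (Finsupp.single (i, a, b) n) = Finsupp.single (i, -b, -a) n :=
  Finsupp.equivMapDomain_single _ _ _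

lemma monomialFlip_apply {κ : Type*} (M : YMonomial κ) (i : κ) (x : ℤ × ℤ) :
    monomialFlip M (i, argumentFlip x) = M (i, x) := by
  change M (i, argumentFlip (argumentFlip x)) = _
  simp [argumentFlip]

lemma monomialFlip_of_offDiagonal {κ : Type*} {M : YMonomial κ} (hM : offDiagonal M = 0) :
    monomialFlip M = M := by
  ext ⟨i, a, b⟩
  change M (i, -b, -a) = M (i, a, b)
  by_cases h : a + b = 0
  · rw [show -b = a by omega, show -a = b by omega]
  · have h' : -b + -a ≠ 0 := by omega
    rw [apply_eq_zero_of_offDiagonal (x := (i, a, b)) hM h,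
      apply_eq_zero_of_offDiagonal (x := (i, -b, -a)) hM h']

lemma monomialFlip_aMonomial (g : SimpleCartanDatum ι) (hC : g.C.IsSimplyLaced) (i : ι)
    (a b : ℤ) : monomialFlip (aMonomial g i a b) = aMonomial g i (-b) (-a) := by
  simp only [aMonomial_of_isSimplyLaced g hC, map_sub, map_add, map_sum, monomialFlip_single]
  congr 3 <;> ring_nf

lemma positions_monomialFlip {κ : Type*} [DecidableEq κ] (i : κ) (M : YMonomial κ) :
    positions i (monomialFlip M) = (positions i M).map argumentFlip.toEmbedding := by
  have hmem : ∀ (N : YMonomial κ) (x : ℤ × ℤ), x ∈ positions i N ↔ N (i, x) ≠ 0 := by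
    intro N x
    simp only [positions, mem_image, mem_filter, Finsupp.mem_support_iff]
    constructor
    · rintro ⟨⟨j, y⟩, ⟨h, rfl⟩, rfl⟩
      exact h
    · exact fun h => ⟨(i, x), ⟨h, rfl⟩, rfl⟩
  ext x
  obtain ⟨y, rfl⟩ := argumentFlip.surjective x
  rw [hmem, monomialFlip_apply, ← hmem]
  simp

lemma isTop_monomialFlip {g : SimpleCartanDatum ι} (hC : g.C.IsSimplyLaced) {i : ι}
    {M : YMonomial ι} (hM : IsTop g i M) : IsTop g i (monomialFlip M) := by
  refine ⟨fun x => ?_, fun x hx y hy => ?_⟩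
  · obtain ⟨y, rfl⟩ := argumentFlip.surjective x
    rw [monomialFlip_apply]
    exact hM.1 y
  · rw [positions_monomialFlip] at hx hy
    obtain ⟨x, hx', rfl⟩ := mem_map.1 hx
    obtain ⟨y, hy', rfl⟩ := mem_map.1 hy
    have := hM.2 x hx' y hy'
    rw [g.r_eq_one hC] at this ⊢
    simp only [argumentFlip, Equiv.coe_toEmbedding, Equiv.coe_fn_mk]
    omega

lemma gammaCoeff_flip {g : SimpleCartanDatum ι} (hC : g.C.IsSimplyLaced) {q t : ℂ}
    (h : Generic q t) (i : ι) (X S : Finset (ℤ × ℤ)) :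
    gammaCoeff g q t i (X.map argumentFlip.toEmbedding) (S.map argumentFlip.toEmbedding) =
      gammaCoeff g t q i X S := by
  unfold gammaCoeff
  rw [← Finset.map_sdiff, prod_map]
  refine prod_congr rfl fun x _ => ?_
  rw [prod_map]
  refine prod_congr rfl fun y _ => ?_
  rw [g.r_eq_one hC, pow_one, pow_one,
    etaRatio_swap (mul_ne_zero (zpow_ne_zero _ h.2.1) (zpow_ne_zero _ h.1)), mul_inv,
    ← zpow_neg, ← zpow_neg, mul_comm]
  simp only [argumentFlip, Equiv.coe_toEmbedding, Equiv.coe_fn_mk]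
  congr 3 <;> ring

lemma slTwoString_flip {g : SimpleCartanDatum ι} (hC : g.C.IsSimplyLaced) {q t : ℂ}
    (h : Generic q t) (i : ι) (M : YMonomial ι) :
    slTwoString g q t i (monomialFlip M) =
      Finsupp.lmapDomain ℂ ℂ monomialFlip (slTwoString g t q i M) := by
  unfold slTwoString
  simp only [map_sum, Finsupp.lmapDomain_apply, Finsupp.mapDomain_single]
  refine (sum_equiv argumentFlip.finsetCongr (fun S => ?_) fun S _ => ?_).symm
  · rw [positions_monomialFlip, mem_powerset, mem_powerset, Equiv.finsetCongr_apply,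
      map_subset_map]
  · rw [positions_monomialFlip, Equiv.finsetCongr_apply, gammaCoeff_flip hC h, sum_map]
    congr 1
    simp only [map_sub, map_sum, monomialFlip_aMonomial g hC, g.r_eq_one hC]
    congr 1
    refine sum_congr rfl fun x _ => ?_
    simp only [argumentFlip, Equiv.coe_toEmbedding, Equiv.coe_fn_mk, Nat.cast_one]
    congr 1 <;> ring

lemma IsPasted.flip {g : SimpleCartanDatum ι} (hC : g.C.IsSimplyLaced) {q t : ℂ}
    (h : Generic q t) {T : YMonomial ι →₀ ℂ} (hT : IsPasted g t q T) :
    IsPasted g q t (Finsupp.lmapDomain ℂ ℂ monomialFlip T) := by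
  intro i
  rw [← Submodule.mem_comap]
  refine Submodule.span_le.2 ?_ (hT i)
  rintro B ⟨M, hM, rfl⟩
  exact Submodule.subset_span ⟨_, isTop_monomialFlip hC hM, (slTwoString_flip hC h i M).symm⟩

lemma lmapDomain_monomialFlip_diagonalPart {κ : Type*} [DecidableEq κ] (T : YMonomial κ →₀ ℂ) :
    Finsupp.lmapDomain ℂ ℂ monomialFlip (diagonalPart T) = diagonalPart T := by
  induction T using Finsupp.induction_linear with
  | zero => simp
  | add S T hS hT => rw [map_add, map_add, hS, hT]
  | single M c =>
    rw [diagonalPart_single]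
    split_ifs with hM
    · rw [Finsupp.lmapDomain_apply, Finsupp.mapDomain_single, monomialFlip_of_offDiagonal hM]
    · rw [map_zero]

theorem IsGenerator.coeff_swap {g : SimpleCartanDatum ι} (hC : g.C.IsSimplyLaced)
    {i : ι} {mult : (ι → ℤ) →₀ ℕ} {R : (lam : ι → ℤ) → Fin (mult lam) → Multiset (ι × ℤ × ℤ)}
    {c : ℂ → ℂ → (lam : ι → ℤ) → Fin (mult lam) → ℂ} (hc : IsGenerator g i mult R c)
    {q t : ℂ} (h : Generic q t) : c t q = c q t := by
  refine hc.unique q t h _ (hc.normalized t q h.swap) ?_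
  rw [← hc.diagonalPart_generatorSum hC h.swap, ← lmapDomain_monomialFlip_diagonalPart,
    hc.diagonalPart_generatorSum hC h.swap]
  exact (hc.pasted t q h.swap).flip hC h

end DeformedW

end

open DeformedW in
theorem theorem2p5 {ι : Type*} [Fintype ι] [DecidableEq ι] (g : SimpleCartanDatum ι) (i : ι)
    (mult : (ι → ℤ) →₀ ℕ)
    (R : (lam : ι → ℤ) → Fin (mult lam) → Multiset (ι × ℤ × ℤ))
    (c : ℂ → ℂ → (lam : ι → ℤ) → Fin (mult lam) → ℂ)
    (hc : IsGenerator g i mult R c) :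
    (∀ q t, Generic q t → ∀ lam k, c q⁻¹ t⁻¹ lam k = c q t lam k) ∧
    (∀ q t, Generic q t → ∀ w ∈ g.weylGroup, ∀ lam : ι → ℤ,
      ∑ k : Fin (mult (w lam)), c q t (w lam) k = ∑ k : Fin (mult lam), c q t lam k) ∧
    (∀ q t, Generic q t → ∀ w ∈ g.weylGroup, ∀ lam : ι → ℤ, mult lam = 1 → mult (w lam) = 1 →
      ∀ (k : Fin (mult lam)) (k' : Fin (mult (w lam))), c q t (w lam) k' = c q t lam k) ∧
    (g.C.IsSimplyLaced → ∀ q t, Generic q t → ∀ lam k, c t q lam k = c q t lam k) := by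
  have single_sum : ∀ {n : ℕ}, n = 1 → ∀ (f : Fin n → ℂ) (k : Fin n), ∑ j, f j = f k := by
    rintro n rfl f k
    rw [Fin.sum_univ_one, Subsingleton.elim k 0]
  refine ⟨fun q t h lam k => by rw [hc.coeff_inv h],
    fun q t h w hw lam => hc.sum_coeff_weylGroup h hw lam,
    fun q t h w hw lam h1 h2 k k' => ?_,
    fun hC q t h lam k => by rw [hc.coeff_swap hC h]⟩
  rw [← single_sum h2 (c q t (w lam)) k', ← single_sum h1 (c q t lam) k]
  exact hc.sum_coeff_weylGroup h hw lam
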